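/- Conventions. For a field $K$ let $K_s$ be a fixed separable closure and $\mathrm{Gal}(K)=\mathrm{Gal}(K_s/K)$; intermediate fields of $K_s/K$ are called separable algebraic extensions of $K$, and $\mathrm{Gal}(L)=\mathrm{Gal}(K_s/L)$ for such $L$. A profinite space is a compact, Hausdorff, totally disconnected space. For a profinite group $G$, the étale topology on the set $\mathrm{Subgr}(G)$ of closed subgroups of $G$ has the basis of sets $\{H : H\le U\}$, $U$ an open subgroup of $G$; the étale topology on the set of separable algebraic extensions of $K$ has the basis of sets $\{E : L\subseteq E\}$, $L/K$ finite separable. All actions are written on the left (a right action $x^g$ is turned into a left action by $gx=x^{g^{-1}}$). A variety over a field is a geometrically integral scheme of finite type over it. Group structures. A group structure $\mathbf G=(G,X,G_x)_{x\in X}$ consists of a profinite group $G$ acting continuously on a profinite space $X$ and an étale continuous map $x\mapsto G_x$ from $X$ to $\mathrm{Subgr}(G)$ such that $G_{gx}=gG_xg^{-1}$ and $S_x:=\{g\in G: gx=x\}\le G_x$ for all $x\in X$, $g\in G$. It is finite if $G$ and $X$ are finite. A morphism $\varphi:(G,X,G_x)_{x\in X}\to(H,Y,H_y)_{y\in Y}$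 is a pair of a continuous homomorphism $\varphi:G\to H$ and a continuous map $\varphi:X\to Y$ with $\varphi(gx)=\varphi(g)\varphi(x)$ and $\varphi(G_x)\le H_{\varphi(x)}$. It is a cover if $\varphi(G)=H$, $\varphi(X)=Y$, each $G_x$ is mapped isomorphically onto $H_{\varphi(x)}$, for each $y\in Y$ there is $x\in X$ with $\varphi(x)=y$ and $\varphi(G_x)=H_y$, and $\varphi(x)=\varphi(x')$ implies $x'=kx$ for some $k\in\mathrm{Ker}(\varphi)$. $\mathbf G$ is projective if for all morphisms $\varphi:\mathbf G\to\mathbf A$ and covers $\alpha:\mathbf B\to\mathbf A$ of group structures with $\mathbf B$ finite there is a morphism $\gamma:\mathbf G\to\mathbf B$ with $\alpha\circ\gamma=\varphi$ (on groups and on spaces). A special partition of $\mathbf G$ is a finite family $(G_i,X_i)_{i\in I_0}$ where $X_i\subseteq X$ is open-closed, $G_i$ is an open subgroup of $G$ with $G_x\le G_i$ for all $x\in X_i$, $G_i=\{g\in G: gX_i=X_i\}$, and there are finite sets $R_i\subseteq G$ such that $G=\bigcup_{\rho\in R_i}\rho G_i$ (disjoint union) for each $i$ and $X=\bigcup_{i\in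 I_0}\bigcup_{\rho\in R_i}\rho X_i$ (disjoint union). Field structures. A field structure $\mathbf K=(K,X,K_x)_{x\in X}$ consists of a field $K$, a profinite space $X$ with a continuous action of $\mathrm{Gal}(K)$, and an étale continuous map $x\mapsto K_x$ from $X$ to the set of separable algebraic extensions of $K$, such that $K_{\sigma x}=\sigma(K_x)$, and $\sigma x=x$ implies $\sigma\in\mathrm{Gal}(K_x)$, for all $x\in X$, $\sigma\in\mathrm{Gal}(K)$. Then $\mathrm{Gal}(\mathbf K)=(\mathrm{Gal}(K),X,\mathrm{Gal}(K_x))_{x\in X}$ is a group structure. A unirational arithmetical problem for $\mathbf K$ is a datum $(V,X_i,L_i,\pi_i:U_i\to V\times_KL_i)_{i\in I_0}$ where the $L_i$ are separable algebraic extensions of $K$ such that $(\mathrm{Gal}(L_i),X_i)_{i\in I_0}$ is a special partition of $\mathrm{Gal}(\mathbf K)$, $V$ is a smooth affine variety over $K$, each $U_i$ is a smooth variety over $L_i$ birationally equivalent over $L_i$ to $\mathbb A^{\dim V}_{L_i}$, and $\pi_i$ is an étale morphism over $L_i$. (It follows that $L_i/K$ is finite and $L_i\subseteq K_x$ for $x\in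 X_i$.) A solution consists of a point $\mathbf a\in V(K)$ and points $\mathbf b_x\in U_i(K_x)$ with $\pi_i(\mathbf b_x)=\mathbf a$, for all $i\in I_0$ and $x\in X_i$. $\mathbf K$ is unirationally closed if each unirational arithmetical problem for $\mathbf K$ has a solution. Proposition 6.4. Let $\mathbf K=(K,X,K_x)_{x\in X}$ be a unirationally closed field structure such that $S_x=\mathrm{Gal}(K_x)$ for each $x\in X$, where $S_x=\{\sigma\in\mathrm{Gal}(K):\sigma x=x\}$. Then $\mathrm{Gal}(\mathbf K)$ is a projective group structure. -/

import Mathlib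

open CategoryTheory CategoryTheory.Limits AlgebraicGeometry
open scoped Pointwise Topology

universe u v u' v'

/-! All group actions are written on the left. A right action `x ^ g` of a group is the left action
`g • x = x ^ (g⁻¹)`, and `Γ ^ g = g⁻¹ Γ g`; under this translation stabilizers, morphisms, covers
and special partitions of right actions become the ones defined below. -/

section EtaleTopology

/-- The étale topology on the set `Subgr(G)` of closed subgroups of `G`: a basis consists of the
sets `Subgr(U)` with `U` an open subgroup of `G`. -/
abbrev subgrEtaleTopology (G : Type u) [Group G] [TopologicalSpace G] :
    TopologicalSpace (ClosedSubgroup G) :=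
  TopologicalSpace.generateFrom
    (Set.range fun U : OpenSubgroup G => {H : ClosedSubgroup G | H.toSubgroup ≤ U.toSubgroup})

/-- The étale topology on the set `SepAlgExt(K)` of separable algebraic extensions of `K` (inside
the fixed separable closure): a basis consists of the sets `SepAlgExt(L)` with `L / K` finite. -/
abbrev sepAlgExtEtaleTopology (K : Type u) [Field K] :
    TopologicalSpace (IntermediateField K (SeparableClosure K)) :=
  TopologicalSpace.generateFrom
    {s | ∃ L : IntermediateField K (SeparableClosure K), FiniteDimensional K L ∧
      s = {E : IntermediateField K (SeparableClosure K) | L ≤ E}}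

end EtaleTopology

/-- A (profinite) group structure `(G, X, G_x)_{x ∈ X}`: a profinite group `G` acting continuously
on a profinite space `X`, and an étale continuous, equivariant family of closed subgroups `G_x`
containing the stabilizers. -/
structure GroupStructure where
  G : Type u
  X : Type v
  [group : Group G]
  [topG : TopologicalSpace G]
  [topGroup : IsTopologicalGroup G]
  [compactG : CompactSpace G]
  [hausdorffG : T2Space G]
  [totDiscG : TotallyDisconnectedSpace G]
  [topX : TopologicalSpace X]
  [compactX : CompactSpace X]
  [hausdorffX : T2Space X]
  [totDiscX : TotallyDisconnectedSpace X]
  [action : MulAction G X]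
  [contAction : ContinuousSMul G X]
  /-- `x ↦ G_x` -/
  sub : X → ClosedSubgroup G
  sub_continuous : Continuous[topX, subgrEtaleTopology G] sub
  sub_smul : ∀ (g : G) (x : X), (sub (g • x)).toSubgroup = MulAut.conj g • (sub x).toSubgroup
  stabilizer_le : ∀ x : X, MulAction.stabilizer G x ≤ (sub x).toSubgroup

namespace GroupStructure

attribute [instance] group topG topGroup compactG hausdorffG totDiscG topX compactX hausdorffX
  totDiscX action contAction

/-- `S` is finite if both the group and the space are finite. -/
def IsFinite (S : GroupStructure.{u, v}) : Prop := Finite S.G ∧ Finite S.X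

/-- Morphisms of group structures. -/
structure Hom (S : GroupStructure.{u, v}) (T : GroupStructure.{u', v'}) where
  onGroup : S.G →* T.G
  onSpace : S.X → T.X
  continuous_onGroup : Continuous onGroup
  continuous_onSpace : Continuous onSpace
  map_smul : ∀ (g : S.G) (x : S.X), onSpace (g • x) = onGroup g • onSpace x
  map_sub_le : ∀ x : S.X, (S.sub x).toSubgroup.map onGroup ≤ (T.sub (onSpace x)).toSubgroup

/-- Epimorphisms of group structures. -/
structure Hom.IsEpi {S : GroupStructure.{u, v}} {T : GroupStructure.{u', v'}} (φ : S.Hom T) :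
    Prop where
  surjective_onGroup : Function.Surjective φ.onGroup
  surjective_onSpace : Function.Surjective φ.onSpace
  exists_map_sub_eq : ∀ y : T.X, ∃ x : S.X, φ.onSpace x = y ∧
    (S.sub x).toSubgroup.map φ.onGroup = (T.sub y).toSubgroup

/-- Covers: epimorphisms which map each `G_x` isomorphically onto `H_{φ(x)}` and whose fibers on
the space are orbits of the kernel. -/
structure Hom.IsCover {S : GroupStructure.{u, v}} {T : GroupStructure.{u', v'}} (φ : S.Hom T) :
    Prop where
  isEpi : φ.IsEpi
  bijOn_sub : ∀ x : S.X, Set.BijOn φ.onGroup (S.sub x) (T.sub (φ.onSpace x))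
  exists_ker_smul_eq : ∀ x x' : S.X, φ.onSpace x = φ.onSpace x' →
    ∃ k ∈ φ.onGroup.ker, k • x = x'

/-- `S` is projective if every finite embedding problem `(φ : S → A, α : B → A)`, with `α` a cover
and `B` finite (so that `A` is finite as well), has a solution `γ : S → B`, `α ∘ γ = φ`.
Every finite structure is isomorphic to one in `Type`, so small `A` and `B` suffice. -/
def IsProjective (S : GroupStructure.{u, v}) : Prop :=
  ∀ (A B : GroupStructure.{0, 0}) (φ : S.Hom A) (α : B.Hom A), B.IsFinite → α.IsCover →
    ∃ γ : S.Hom B, (∀ g, α.onGroup (γ.onGroup g) = φ.onGroup g) ∧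
      (∀ x, α.onSpace (γ.onSpace x) = φ.onSpace x)

/-- A special partition `(G_i, X_i, R_i)_{i ∈ I}` of `S`; the unions `G = ⋃ ρ G_i` over
`ρ ∈ R_i` and `X = ⋃ ρ X_i` over `i ∈ I`, `ρ ∈ R_i` are disjoint. -/
structure IsSpecialPartitionWith (S : GroupStructure.{u, v}) {I : Type} (H : I → Subgroup S.G)
    (Y : I → Set S.X) (R : I → Finset S.G) : Prop where
  finite : Finite I
  isClopen : ∀ i, IsClopen (Y i)
  isOpen : ∀ i, IsOpen (H i : Set S.G)
  sub_le : ∀ i, ∀ x ∈ Y i, (S.sub x).toSubgroup ≤ H i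
  mem_iff : ∀ i (g : S.G), g ∈ H i ↔ g • Y i = Y i
  cosets : ∀ i (g : S.G), ∃! ρ : S.G, ρ ∈ R i ∧ g ∈ ρ • (H i : Set S.G)
  translates : ∀ x : S.X, ∃! p : I × S.G, p.2 ∈ R p.1 ∧ x ∈ p.2 • Y p.1

/-- `(G_i, X_i)_{i ∈ I}` is a special partition if suitable `R_i` exist. -/
def IsSpecialPartition (S : GroupStructure.{u, v}) {I : Type} (H : I → Subgroup S.G)
    (Y : I → Set S.X) : Prop :=
  ∃ R : I → Finset S.G, S.IsSpecialPartitionWith H Y R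

end GroupStructure

/-- A field structure `(K, X, K_x)_{x ∈ X}` over the field `K`. -/
structure FieldStructure (K : Type u) [Field K] where
  X : Type v
  [topX : TopologicalSpace X]
  [compactX : CompactSpace X]
  [hausdorffX : T2Space X]
  [totDiscX : TotallyDisconnectedSpace X]
  [action : MulAction Gal(SeparableClosure K/K) X]
  [contAction : ContinuousSMul Gal(SeparableClosure K/K) X]
  /-- `x ↦ K_x` -/
  fld : X → IntermediateField K (SeparableClosure K)
  fld_continuous : Continuous[topX, sepAlgExtEtaleTopology K] fld
  fld_smul : ∀ (σ : Gal(SeparableClosure K/K)) (x : X),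
    fld (σ • x) = (fld x).map (σ : SeparableClosure K →ₐ[K] SeparableClosure K)
  mem_of_smul_eq : ∀ (σ : Gal(SeparableClosure K/K)) (x : X), σ • x = x →
    σ ∈ (fld x).fixingSubgroup

namespace FieldStructure

attribute [instance] topX compactX hausdorffX totDiscX action contAction

variable {K : Type u} [Field K]

theorem isOpen_setOf_le (S : FieldStructure.{u, v} K)
    (L : IntermediateField K (SeparableClosure K)) [FiniteDimensional K L] :
    IsOpen {x : S.X | L ≤ S.fld x} :=
  continuous_generateFrom_iff.mp S.fld_continuous _ ⟨L, inferInstance, rfl⟩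

/-- The absolute Galois group structure `Gal(𝐊) = (Gal(K), X, Gal(K_x))_{x ∈ X}` of a field
structure. -/
noncomputable abbrev gal (S : FieldStructure.{u, v} K) : GroupStructure.{u, v} where
  G := Gal(SeparableClosure K/K)
  X := S.X
  hausdorffG := krullTopology_t2
  sub x := ⟨(S.fld x).fixingSubgroup, InfiniteGalois.fixingSubgroup_isClosed _⟩
  sub_continuous := by
    refine continuous_generateFrom_iff.mpr ?_
    rintro _ ⟨U, rfl⟩
    let C : ClosedSubgroup Gal(SeparableClosure K/K) := ⟨U.toSubgroup, U.isClosed⟩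
    let L : IntermediateField K (SeparableClosure K) :=
      IntermediateField.fixedField U.toSubgroup
    have hL : L.fixingSubgroup = U.toSubgroup := InfiniteGalois.fixingSubgroup_fixedField C
    have : FiniteDimensional K L := by
      rw [← InfiniteGalois.isOpen_iff_finite, hL]
      exact U.isOpen
    convert S.isOpen_setOf_le L using 1
    ext x
    change (S.fld x).fixingSubgroup ≤ U.toSubgroup ↔ L ≤ S.fld x
    rw [← hL]
    constructor
    · intro h
      rw [← InfiniteGalois.fixedField_fixingSubgroup (S.fld x)]
      exact (IntermediateField.le_iff_le _ _).mpr h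
    · intro h
      exact IntermediateField.fixingSubgroup_antitone h
  sub_smul σ x := by
    change (S.fld (σ • x)).fixingSubgroup = MulAut.conj σ • (S.fld x).fixingSubgroup
    rw [S.fld_smul, IsGalois.map_fixingSubgroup]
  stabilizer_le x σ hσ := S.mem_of_smul_eq σ x hσ

end FieldStructure

section Varieties

/-- The morphism `Spec L ⟶ Spec K` attached to a `K`-algebra `L`. -/
noncomputable abbrev specAlgebraMap (K L : Type u) [CommRing K] [CommRing L] [Algebra K L] :
    Spec (.of L) ⟶ Spec (.of K) :=
  Spec.map (CommRingCat.ofHom (algebraMap K L))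

/-- A smooth (absolutely irreducible) variety over a field `K`: a geometrically integral smooth
scheme of finite type over `K`. -/
structure IsSmoothVariety {K : Type u} [Field K] {V : Scheme.{u}} (f : V ⟶ Spec (.of K)) :
    Prop where
  geometricallyIntegral : GeometricallyIntegral f
  locallyOfFiniteType : LocallyOfFiniteType f
  quasiCompact : QuasiCompact f
  smooth : Smooth f

/-- Birational equivalence of `S`-schemes: they have isomorphic (over `S`) dense open
subschemes. -/
def BirationallyEquivalentOver {S V W : Scheme.{u}} (f : V ⟶ S) (g : W ⟶ S) : Prop :=
  ∃ (V₀ : V.Opens) (W₀ : W.Opens), Dense (V₀ : Set V) ∧ Dense (W₀ : Set W) ∧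
    ∃ e : V₀.toScheme ≅ W₀.toScheme, e.hom ≫ W₀.ι ≫ g = V₀.ι ≫ f

/-- `V / S` is birationally equivalent to the affine space of dimension `n` over `S`. -/
def BirationalToAffineSpace {S V : Scheme.{u}} (f : V ⟶ S) (n : ℕ) : Prop :=
  BirationallyEquivalentOver f (𝔸(ULift.{u} (Fin n); S) ↘ S)

end Varieties

/-- A unirational arithmetical problem `(V, X_i, L_i, π_i : U_i ⟶ V ×_K L_i)_{i ∈ I}` for the
field structure `S`. -/
structure UnirationalProblem {K : Type u} [Field K] (S : FieldStructure.{u, v} K) where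
  I : Type
  /-- `X_i` -/
  Y : I → Set S.X
  /-- `L_i` -/
  L : I → IntermediateField K (SeparableClosure K)
  isSpecialPartition : S.gal.IsSpecialPartition (fun i => (L i).fixingSubgroup) Y
  V : Scheme.{u}
  /-- structure morphism of `V` -/
  f : V ⟶ Spec (.of K)
  isAffine : IsAffine V
  isSmoothVariety : IsSmoothVariety f
  U : I → Scheme.{u}
  /-- structure morphism of `U_i` -/
  g : ∀ i, U i ⟶ Spec (.of (L i))
  isSmoothVariety_U : ∀ i, IsSmoothVariety (g i)
  /-- `n = dim V` -/
  n : ℕ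
  dim_eq : topologicalKrullDim V = n
  birational : ∀ i, BirationalToAffineSpace (g i) n
  π : ∀ i, U i ⟶ pullback f (specAlgebraMap K (L i))
  /-- `π_i` is a morphism over `L_i` -/
  π_snd : ∀ i, π i ≫ pullback.snd f (specAlgebraMap K (L i)) = g i
  etale : ∀ i, Etale (π i)

namespace UnirationalProblem

variable {K : Type u} [Field K] {S : FieldStructure.{u, v} K}

theorem le_fld (P : UnirationalProblem S) (i : P.I) (x : S.X) (hx : x ∈ P.Y i) :
    P.L i ≤ S.fld x := by
  obtain ⟨R, hR⟩ := P.isSpecialPartition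
  have h : (S.fld x).fixingSubgroup ≤ (P.L i).fixingSubgroup := hR.sub_le i x hx
  rw [← InfiniteGalois.fixedField_fixingSubgroup (S.fld x)]
  exact (IntermediateField.le_iff_le _ _).mpr h

/-- The set `V(K)` of `K`-rational points. -/
abbrev Point (P : UnirationalProblem S) : Type u :=
  {a : Spec (.of K) ⟶ P.V // a ≫ P.f = 𝟙 _}

/-- The set `U_i(K_x)`, `x ∈ X_i`, of `K_x`-rational points of the `L_i`-scheme `U_i`. -/
abbrev LocalPoint (P : UnirationalProblem S) (i : P.I) (x : S.X) (hx : x ∈ P.Y i) : Type u :=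
  {b : Spec (.of (S.fld x)) ⟶ P.U i // b ≫ P.g i =
    Spec.map (CommRingCat.ofHom (IntermediateField.inclusion (P.le_fld i x hx)).toRingHom)}

/-- The problem has a solution: there are `a ∈ V(K)` and, for all `i` and `x ∈ X_i`, a point
`b_x ∈ U_i(K_x)` such that `π_i(b_x) = a` in `V(K_x)`. -/
def HasSolution (P : UnirationalProblem S) : Prop :=
  ∃ a : P.Point, ∀ (i : P.I) (x : S.X) (hx : x ∈ P.Y i), ∃ b : P.LocalPoint i x hx,
    b.1 ≫ P.π i ≫ pullback.fst P.f (specAlgebraMap K (P.L i)) =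
      specAlgebraMap K (S.fld x) ≫ a.1

end UnirationalProblem

/-- A field structure is unirationally closed if each unirational arithmetical problem for it has
a solution. -/
def FieldStructure.IsUnirationallyClosed {K : Type u} [Field K] (S : FieldStructure.{u, v} K) :
    Prop :=
  ∀ P : UnirationalProblem S, P.HasSolution

/-! The argument translates a finite embedding problem `φ : Gal(𝐊) → 𝐀 ← 𝐁 : α` into a unirational
arithmetical problem.

Let `L / K` be the finite Galois extension cut out by the kernel of `φ` and `B = α⁻¹(φ(Gal(K)))`, which
acts on `L` through an epimorphism `β : B → Gal(L/K)`. Let `B` act on the polynomial ring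
`P = L[X_b : b ∈ B]`, on the coefficients through `β` and on the variables by translation. After
inverting a suitable invariant `d` (`IsSeparating`, `exists_isSeparating_mvPolynomial`), this action is
free, so that `P[1/d]` is a Galois étale cover of the localized invariants `P^B[1/d]`
(`IsSeparating.etale`, `IsSeparating.exists_extension`, `IsSeparating.exists_smul_of_eq`). A point of
`V = Spec P^B[1/d]` over `K` therefore yields a homomorphism `γ : Gal(K) → B` with `β ∘ γ` the
restriction to `L`, and if the point lifts to a point of `Spec P^H[1/d]` over `K_x`, then
`γ(Gal(K_x))` is contained in a conjugate of `H`
(`exists_monoidHom_of_isUnirationallyClosed`).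

If `β` is injective on `H`, then `H` acts faithfully on the coefficients and Galois descent for the
space of linear forms shows that `P^H` is a polynomial ring over the fixed field
(`exists_ringEquiv_invariants`), so that `Spec P^H[1/d]` is rational. The groups `B_y` of a cover have
this property, and so the fibres of `φ` over representatives of the orbits, a special partition because
`S_x = Gal(K_x)` (`GroupStructure.isSpecialPartition_fibers`), give rise to a unirational arithmetical
problem (`exists_rational_points`). Smoothness of `V` follows from the fact that the invariants of the
larger group `Gal(L/K) × Perm(B)` are the polynomials over `K` in the elementary symmetric functions, over
which all the rings in question are étale after inverting `d`.

The solution provides `γ` and, for each `x`, a point `y` over `φ(x)` with `γ(Gal(K_x)) ≤ B_y`. In a cover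
`γ(S_x)` then fixes `y`, so `x ↦ y` extends equivariantly to a neighbourhood of the orbit of `x`, and
by compactness finitely many such extensions combine to a map on all of `X`
(`GroupStructure.exists_hom_lift`). -/

/-! ### The polynomial of the conjugates of an element -/

section SeparatingElement

open Polynomial MulAction

variable {G P A : Type*} [Group G] [CommRing P] [MulSemiringAction G P] [CommRing A] [Algebra A P]

theorem exists_map_eq_of_forall_smul_eq [Algebra.IsInvariant A P G] (N : P[X])
    (hN : ∀ g : G, g • N = N) : ∃ M : A[X], M.map (algebraMap A P) = N := by
  have : N ∈ lifts (algebraMap A P) := by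
    rw [lifts_iff_coeff_lifts]
    intro k
    obtain ⟨a, ha⟩ := Algebra.IsInvariant.isInvariant (A := A) (B := P) (G := G) (N.coeff k)
      fun g => by rw [← coeff_smul, hN]
    exact ⟨a, ha⟩
  exact (mem_lifts _).mp this

/-- Lagrange interpolation on the orbit of `x`, multiplied by the denominator `f'(x)`, where `f` is
the polynomial whose roots are the conjugates of `x`. -/
theorem exists_smul_invariant_eval_eq [Fintype G] (x r : P) (h : stabilizer G x ≤ stabilizer G r) :
    ∃ N : P[X], (∀ g : G, g • N = N) ∧
      N.eval x = r * (derivative (prodXSubSMul G P x)).eval x := by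
  classical
  let ρ : G ⧸ stabilizer G x → P := fun q => Quotient.liftOn' q (· • r) fun g₁ g₂ H => by
    have : (g₁⁻¹ * g₂) • r = r := h (QuotientGroup.leftRel_apply.mp H)
    change g₁ • r = g₂ • r
    rw [← this, smul_smul, mul_inv_cancel_left, this]
  have hρ : ∀ (g : G) (q), ρ (g • q) = g • ρ q := fun g q =>
    Quotient.inductionOn' q fun k => mul_smul g k r
  let ξ := ofQuotientStabilizer G x
  let F : G ⧸ stabilizer G x → P[X] := fun q => ∏ q' ∈ Finset.univ.erase q, (X - C (ξ q'))
  have hF : ∀ (g : G) q, g • F q = F (g • q) := by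
    intro g q
    rw [Finset.smul_prod']
    refine Finset.prod_bij (fun q' _ => g • q') ?_ ?_ ?_ ?_
    · intro a ha
      simpa using ha
    · intro a _ b _ hab
      simpa using hab
    · intro b hb
      refine ⟨g⁻¹ • b, ?_, by simp⟩
      simp only [Finset.mem_erase, Finset.mem_univ, and_true] at hb ⊢
      rintro rfl
      simp at hb
    · intro a _
      rw [smul_sub, smul_X, smul_C]
      exact congrArg (fun t => X - C t) (ofQuotientStabilizer_smul G x g a).symm
  have hFx : ∀ q, q ≠ ((1 : G) : G ⧸ stabilizer G x) → (F q).eval x = 0 := by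
    intro q hq
    rw [eval_prod]
    refine Finset.prod_eq_zero (i := ((1 : G) : G ⧸ stabilizer G x)) ?_ ?_
    · simpa using hq.symm
    · simp [ξ]
  refine ⟨∑ q, C (ρ q) * F q, ?_, ?_⟩
  · intro g
    rw [Finset.smul_sum]
    refine Fintype.sum_bijective (g • ·) (MulAction.bijective g) _ _ fun q => ?_
    rw [smul_mul', smul_C, hF, hρ]
  · rw [eval_finsetSum, Finset.sum_eq_single ((1 : G) : G ⧸ stabilizer G x)]
    · rw [prodXSubSMul, derivative_prod_finset, eval_finsetSum,
        Finset.sum_eq_single ((1 : G) : G ⧸ stabilizer G x)]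
      · rw [eval_mul, eval_C]
        have : ρ ((1 : G) : G ⧸ stabilizer G x) = r := one_smul G r
        rw [this]
        congr 1
        simp only [derivative_sub, derivative_X, derivative_C, sub_zero, mul_one]
        rfl
      · intro q _ hq
        simp only [derivative_sub, derivative_X, derivative_C, sub_zero, mul_one]
        exact hFx q hq
      · simp
    · intro q _ hq
      rw [eval_mul, hFx q hq, mul_zero]
    · simp

/-- The derivative at `x` of the polynomial whose roots are the conjugates of `x` is the product of the
differences of `x` and its other conjugates. -/
theorem eval_derivative_prodXSubSMul_dvd [Fintype G] (x d : P)
    (hd : ∀ g : G, g • x ≠ x → g • x - x ∣ d) :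
    ∃ m : ℕ, (derivative (prodXSubSMul G P x)).eval x ∣ d ^ m := by
  classical
  rw [prodXSubSMul, derivative_prod_finset, eval_finsetSum,
    Finset.sum_eq_single ((1 : G) : G ⧸ stabilizer G x)]
  · simp only [derivative_sub, derivative_X, derivative_C, sub_zero, mul_one]
    rw [eval_prod]
    refine ⟨(Finset.univ.erase ((1 : G) : G ⧸ stabilizer G x)).card, ?_⟩
    rw [← Finset.prod_const]
    refine Finset.prod_dvd_prod_of_dvd _ _ fun q hq => ?_
    induction q using QuotientGroup.induction_on with
    | H g =>
      simp only [Finset.mem_erase, Finset.mem_univ, and_true] at hq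
      simp only [ofQuotientStabilizer_mk, eval_sub, eval_X, eval_C]
      rw [← neg_dvd, neg_sub]
      refine hd g fun hg => hq ?_
      rw [QuotientGroup.eq]
      simpa [mem_stabilizer_iff] using hg
  · intro q _ hq
    rw [eval_mul, eval_prod]
    rw [Finset.prod_eq_zero (i := ((1 : G) : G ⧸ stabilizer G x)), zero_mul]
    · simpa using hq.symm
    · simp
  · simp

variable (G) in
/-- If the differences of the conjugates of `x` divide the invariant element `d`, then, after
inverting `d`, the invariants of the stabilizer of `x` are the standard étale algebra
`A[T] / (f)`, where `f` is the polynomial whose roots are the conjugates of `x`. -/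
theorem exists_monic_of_forall_sub_dvd [Finite G] [IsDomain P] [Algebra.IsInvariant A P G]
    [SMulCommClass G A P] [FaithfulSMul A P] (x : P) (d : A) (hd0 : d ≠ 0)
    (hd : ∀ g : G, g • x ≠ x → g • x - x ∣ algebraMap A P d) :
    ∃ f : A[X], f.Monic ∧ f.natDegree ≠ 0 ∧
      (∃ Q : Finset G, f.map (algebraMap A P) = ∏ g ∈ Q, (X - C (g • x))) ∧
      aeval x f = 0 ∧ (∀ h : A[X], aeval x h = 0 → f ∣ h) ∧
      ∃ n : ℕ, (∃ p₁ p₂ : A[X], derivative f * p₁ + f * p₂ = C d ^ n) ∧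
        ∀ r : P, stabilizer G x ≤ stabilizer G r →
          ∃ N : A[X], aeval x N = r * algebraMap A P d ^ n := by
  classical
  have := Fintype.ofFinite G
  have hinj : Function.Injective (algebraMap A P) := FaithfulSMul.algebraMap_injective A P
  have hdom : IsDomain A := hinj.isDomain _
  set F := prodXSubSMul G P x with hF
  obtain ⟨f, hf⟩ := exists_map_eq_of_forall_smul_eq (A := A) F (prodXSubSMul.smul G P x)
  have hfm : f.Monic := by
    have : (f.map (algebraMap A P)).Monic := hf ▸ prodXSubSMul.monic G P x
    exact Polynomial.monic_of_injective hinj this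
  have hfx : aeval x f = 0 := by
    rw [aeval_def, ← Polynomial.eval_map, hf, prodXSubSMul.eval]
  have hdeg : f.natDegree = Nat.card (G ⧸ stabilizer G x) := by
    rw [← natDegree_map_eq_of_injective hinj, hf, hF, prodXSubSMul,
      natDegree_finsetProd_X_sub_C_eq_card, Nat.card_eq_fintype_card, Finset.card_univ]
  have hf' : ∀ y : P, aeval y (derivative f) = (derivative F).eval y := fun y => by
    rw [aeval_def, ← Polynomial.eval_map, ← derivative_map, hf]
  have hmin : ∀ h : A[X], aeval x h = 0 → f ∣ h := by
    intro h hh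
    rw [← modByMonic_eq_zero_iff_dvd hfm]
    set r := h %ₘ f with hr
    have hrx : aeval x r = 0 := by rw [hr, aeval_modByMonic_eq_self_of_root hfx, hh]
    apply Polynomial.map_injective _ hinj
    rw [Polynomial.map_zero]
    refine eq_zero_of_natDegree_lt_card_of_eval_eq_zero _
      (injective_ofQuotientStabilizer G x) (fun q => ?_) ?_
    · induction q using QuotientGroup.induction_on with
      | H g =>
        rw [ofQuotientStabilizer_mk, eval_smul']
        have : g⁻¹ • r.map (algebraMap A P) = r.map (algebraMap A P) := by
          ext k
          rw [coeff_smul, coeff_map, smul_algebraMap]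
        rw [this, Polynomial.eval_map, ← aeval_def, hrx, smul_zero]
    · rw [← Nat.card_eq_fintype_card, ← hdeg, natDegree_map_eq_of_injective hinj]
      refine natDegree_modByMonic_lt _ hfm fun h1 => ?_
      rw [h1] at hdeg
      simp only [natDegree_one] at hdeg
      exact Nat.card_pos.ne hdeg
  have hdP : algebraMap A P d ≠ 0 := by simpa using hinj.ne hd0
  obtain ⟨m, s, hs⟩ := eval_derivative_prodXSubSMul_dvd x (algebraMap A P d) hd
  have hint : ∀ r : P, stabilizer G x ≤ stabilizer G r →
      ∃ N : A[X], aeval x N = r * aeval x (derivative f) := by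
    intro r hr
    obtain ⟨N, hN, hNx⟩ := exists_smul_invariant_eval_eq x r hr
    obtain ⟨M, rfl⟩ := exists_map_eq_of_forall_smul_eq (A := A) N hN
    exact ⟨M, by rw [hf', aeval_def, ← Polynomial.eval_map, hNx]⟩
  -- `s` is the quotient `d ^ m / f'(x)`, hence invariant under the stabilizer of `x`.
  have hsx : stabilizer G x ≤ stabilizer G s := by
    intro g hg
    have h0 : (derivative F).eval x ≠ 0 := fun h0 => by
      rw [← hF, h0, zero_mul] at hs
      exact pow_ne_zero m hdP hs
    have h1 : g • (derivative F).eval x = (derivative F).eval x := by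
      rw [← hf']
      change g • x = x at hg
      have : g • aeval x (derivative f) = aeval (g • x) (derivative f) := by
        rw [aeval_def, aeval_def, ← Polynomial.eval_map, ← Polynomial.eval_map, eval_smul']
        congr 2
        ext k
        rw [coeff_smul, coeff_map, smul_algebraMap]
      rw [this, hg]
    change g • s = s
    apply mul_left_cancel₀ h0
    rw [← hF] at hs
    rw [← hs]
    conv_lhs => rw [← h1, ← smul_mul', ← hs, smul_pow', smul_algebraMap]
  have hss : stabilizer G x ≤ stabilizer G (s * s) := fun g hg => by
    change g • (s * s) = s * s
    rw [smul_mul', show g • s = s from hsx hg]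
  obtain ⟨V, hV⟩ := hint (s * s) hss
  have hVx : aeval x (derivative f) * aeval x V = algebraMap A P d ^ (2 * m) := by
    rw [hV, two_mul, pow_add, hs, hf']
    ring
  refine ⟨f, hfm, hdeg ▸ Nat.card_pos.ne', ?_, hfx, hmin, 2 * m, ?_, ?_⟩
  · refine ⟨Finset.univ.image (Quotient.out : G ⧸ stabilizer G x → G), ?_⟩
    rw [hf, hF, prodXSubSMul, Finset.prod_image (fun a _ b _ h => Quotient.out_injective h)]
    refine Finset.prod_congr rfl fun q _ => ?_
    conv_lhs => rw [← QuotientGroup.out_eq' q, ofQuotientStabilizer_mk]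
  · obtain ⟨U, hU⟩ := hmin (derivative f * V - C d ^ (2 * m)) (by
      rw [map_sub, map_mul, hVx, map_pow, aeval_C, sub_self])
    exact ⟨V, -U, by linear_combination hU⟩
  · intro r hr
    obtain ⟨N, hN⟩ := hint r hr
    exact ⟨N * V, by rw [map_mul, hN, mul_assoc, hVx]⟩

end SeparatingElement

/-! ### Separating elements: étale localizations of invariant rings -/

section StandardEtale

open Polynomial

/-- A localization of a monogenic algebra `A[x]` in which `f'(x)` is invertible, where `f` is a monic
polynomial generating the relations of `x`, is standard étale. -/
theorem exists_standardEtalePresentation {A A₁ R : Type*} [CommRing A] [CommRing A₁]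
    [CommRing R] [Algebra A A₁] [Algebra A₁ R] [Algebra A R] [IsScalarTower A A₁ R] (d : A)
    [IsLocalization.Away (algebraMap A A₁ d) R] (hd : algebraMap A A₁ d ∈ nonZeroDivisors A₁)
    (f : A[X]) (hf : f.Monic) (x : A₁) (hx : aeval x f = 0)
    (hmin : ∀ h : A[X], aeval x h = 0 → f ∣ h) (n : ℕ)
    (hcond : ∃ p₁ p₂ : A[X], derivative f * p₁ + f * p₂ = C d ^ n)
    (hgen : ∀ r : A₁, ∃ N : A[X], aeval x N = r * algebraMap A A₁ d ^ n) :
    ∃ Q : StandardEtalePresentation A R, Q.f = f ∧ Q.g = C d := by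
  have hinj : Function.Injective (algebraMap A₁ R) :=
    IsLocalization.injective R (Submonoid.powers_le.mpr hd)
  obtain ⟨p₁, p₂, hp⟩ := hcond
  let Q : StandardEtalePair A := ⟨f, hf, C d, p₁, p₂, n, hp⟩
  have hdu : IsUnit (algebraMap A R d) := by
    rw [IsScalarTower.algebraMap_apply A A₁ R]
    exact IsLocalization.Away.algebraMap_isUnit _
  have hQ : Q.HasMap (algebraMap A₁ R x) := by
    refine ⟨?_, ?_⟩
    · rw [aeval_algebraMap_apply, hx, map_zero]
    · simpa [Q] using hdu
  have hlift : ∀ p : A[X], Q.lift _ hQ (aeval Q.X p) = algebraMap A₁ R (aeval x p) := by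
    intro p
    rw [← aeval_algHom_apply, Q.lift_X, aeval_algebraMap_apply]
  refine ⟨{ P := Q, x := _, hasMap := hQ, lift_bijective := ⟨?_, ?_⟩ }, rfl, rfl⟩
  · rw [injective_iff_map_eq_zero]
    intro y hy
    let PQ : StandardEtalePresentation A Q.Ring :=
      ⟨Q, Q.X, Q.hasMap_X, by simpa [StandardEtalePair.lift_X_left] using Function.bijective_id⟩
    obtain ⟨p, k, hpk⟩ := PQ.exists_mul_aeval_x_g_pow_eq_aeval_x y
    have h1 : aeval x p = 0 := by
      apply hinj
      rw [map_zero, ← hlift]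
      change Q.lift _ hQ (aeval PQ.x p) = 0
      rw [← hpk, map_mul, hy, zero_mul]
    obtain ⟨q, rfl⟩ := hmin p h1
    have hX : aeval PQ.x f = 0 := Q.hasMap_X.1
    rw [map_mul, hX, zero_mul] at hpk
    exact (IsUnit.mul_left_eq_zero (Q.hasMap_X.2.pow k)).mp hpk
  · intro y
    obtain ⟨r, ⟨_, k, rfl⟩, hr⟩ := IsLocalization.exists_mk'_eq
      (Submonoid.powers (algebraMap A A₁ d)) y
    obtain ⟨N, hN⟩ := hgen r
    have hu := Q.hasMap_X.2
    refine ⟨aeval Q.X N * ↑(hu.unit⁻¹) ^ (n + k), ?_⟩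
    have e1 : Q.lift _ hQ (↑(hu.unit⁻¹) : Q.Ring) * algebraMap A R d = 1 := by
      have : (aeval Q.X Q.g) = algebraMap A Q.Ring d := by simp [Q]
      rw [← AlgHom.commutes (Q.lift _ hQ) d, ← this, ← map_mul]
      rw [IsUnit.val_inv_mul, map_one]
    have e2 : y * algebraMap A R d ^ k = algebraMap A₁ R r := by
      rw [← hr, IsScalarTower.algebraMap_apply A A₁ R, ← map_pow]
      exact IsLocalization.mk'_spec _ _ _
    rw [map_mul, map_pow, hlift, hN, map_mul, ← e2, map_pow, ← IsScalarTower.algebraMap_apply]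
    calc _ = y * (Q.lift _ hQ (↑(hu.unit⁻¹) : Q.Ring) * algebraMap A R d) ^ (n + k) := by ring
      _ = y := by rw [e1, one_pow, mul_one]

end StandardEtale

section Invariants

open Polynomial MulAction

variable {Γ P : Type*} [Group Γ] [CommRing P] [MulSemiringAction Γ P]

variable (P) in
/-- The ring `P ^ C` of invariants of a subgroup `C` of `Γ` in a ring `P` on which `Γ` acts. -/
def invariants (C : Subgroup Γ) : Subring P := FixedPoints.subring P C

theorem mem_invariants {C : Subgroup Γ} {p : P} : p ∈ invariants P C ↔ ∀ g ∈ C, g • p = p :=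
  ⟨fun h g hg => h ⟨g, hg⟩, fun h g => h g g.2⟩

theorem invariants_antitone {C D : Subgroup Γ} (h : C ≤ D) : invariants P D ≤ invariants P C :=
  fun _ hp => mem_invariants.mpr fun g hg => mem_invariants.mp hp g (h hg)

instance (C : Subgroup Γ) : SMulCommClass C (invariants P C) P :=
  inferInstanceAs (SMulCommClass C (FixedPoints.subring P C) P)

instance (C : Subgroup Γ) : Algebra.IsInvariant (invariants P C) P C where
  isInvariant b hb := ⟨⟨b, hb⟩, rfl⟩

/-- An invariant element `d ≠ 0` of `P` is separating if each subgroup `C` of `Γ` is the stabilizer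
of an element of `P` the differences of whose conjugates divide `d`. After inverting such a `d`,
the group `Γ` acts freely and the invariants of all subgroups are étale over those of `Γ`. -/
structure IsSeparating (Γ : Type*) {P : Type*} [Group Γ] [CommRing P] [MulSemiringAction Γ P]
    (d : P) : Prop where
  smul_eq : ∀ g : Γ, g • d = d
  ne_zero : d ≠ 0
  exists_stabilizer : ∀ C : Subgroup Γ, ∃ x : P, (∀ g : Γ, g • x = x ↔ g ∈ C) ∧
    ∀ g : Γ, g • x ≠ x → g • x - x ∣ d

namespace IsSeparating

variable {d : P} (hd : IsSeparating Γ d)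

include hd

theorem mem (C : Subgroup Γ) : d ∈ invariants P C := mem_invariants.mpr fun g _ => hd.smul_eq g

variable [Finite Γ] [IsDomain P]

/-- After inverting `d`, the invariants of `C` are étale over the invariants of a larger group `D`: they
are generated by an element with stabilizer `C`. -/
theorem etale {C D : Subgroup Γ} (h : C ≤ D) (R : Type*) [CommRing R]
    [Algebra (invariants P C) R]
    [IsLocalization.Away (⟨d, hd.mem C⟩ : invariants P C) R] :
    ((algebraMap (invariants P C) R).comp
      (Subring.inclusion (invariants_antitone h))).Etale := by
  obtain ⟨x, hx, hxd⟩ := hd.exists_stabilizer C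
  obtain ⟨f, hf, -, -, hfx, hmin, n, hcond, hgen⟩ := exists_monic_of_forall_sub_dvd D x
    (⟨d, hd.mem D⟩ : invariants P D) (fun h0 => hd.ne_zero congr($h0.1)) fun g hg => hxd g hg
  let : Algebra (invariants P D) (invariants P C) :=
    (Subring.inclusion (invariants_antitone h)).toAlgebra
  let : Algebra (invariants P D) R := ((algebraMap (invariants P C) R).comp
      (Subring.inclusion (invariants_antitone h))).toAlgebra
  have : IsScalarTower (invariants P D) (invariants P C) R := .of_algebraMap_eq' rfl
  let x' : invariants P C := ⟨x, mem_invariants.mpr fun g hg => (hx g).mpr hg⟩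
  have hx' : ∀ p : (invariants P D)[X], ((aeval x' p : invariants P C) : P) = aeval x p := by
    intro p
    rw [aeval_def, aeval_def, ← Subring.coe_subtype, hom_eval₂]
    rfl
  have : IsLocalization.Away (algebraMap (invariants P D) (invariants P C) ⟨d, hd.mem D⟩) R :=
    ‹IsLocalization.Away (⟨d, hd.mem C⟩ : invariants P C) R›
  obtain ⟨Q, -⟩ := exists_standardEtalePresentation (R := R) (A₁ := invariants P C)
    (⟨d, hd.mem D⟩ : invariants P D)
    (mem_nonZeroDivisors_of_ne_zero fun h0 => hd.ne_zero congr($h0.1)) f hf x'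
    (Subtype.ext ((hx' f).trans hfx))
    (fun q hq => hmin q (by rw [← hx', hq]; rfl)) n hcond (by
      intro r
      obtain ⟨N, hN⟩ := hgen r fun g hg => mem_invariants.mp r.2 g ((hx g).mp hg)
      exact ⟨N, Subtype.ext ((hx' N).trans hN)⟩)
  have : Algebra.IsStandardEtale (invariants P D) R := ⟨⟨Q⟩⟩
  have : Algebra.Etale (invariants P D) R := inferInstance
  exact this

/-- A point of `P ^ C` at which `d` does not vanish, with values in a separably closed field, lifts to a
point of `P`, since `P[1/d]` is standard étale over `P ^ C`. -/
theorem exists_extension (C : Subgroup Γ) {Ω : Type*} [Field Ω] [IsSepClosed Ω]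
    (w : invariants P C →+* Ω) (hw : w ⟨d, hd.mem C⟩ ≠ 0) :
    ∃ w' : P →+* Ω, ∀ p : invariants P C, w' p = w p := by
  obtain ⟨x, hx, hxd⟩ := hd.exists_stabilizer ⊥
  obtain ⟨f, hf, hf0, -, hfx, hmin, n, hcond, hgen⟩ := exists_monic_of_forall_sub_dvd C x
    (⟨d, hd.mem C⟩ : invariants P C) (fun h0 => hd.ne_zero congr($h0.1)) fun g hg => hxd g hg
  have : IsLocalization.Away (algebraMap (invariants P C) P ⟨d, hd.mem C⟩)
      (Localization.Away d) := inferInstanceAs (IsLocalization.Away d (Localization.Away d))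
  obtain ⟨Q, hQf, hQg⟩ := exists_standardEtalePresentation (R := Localization.Away d)
    (A₁ := P) (⟨d, hd.mem C⟩ : invariants P C)
    (mem_nonZeroDivisors_of_ne_zero hd.ne_zero) f hf x hfx hmin n hcond (by
      intro r
      refine hgen r fun g hg => ?_
      have : (g : Γ) = 1 := Subgroup.mem_bot.mp ((hx g).mp hg)
      change (g : Γ) • r = r
      rw [this, one_smul])
  let : Algebra (invariants P C) Ω := w.toAlgebra
  obtain ⟨p₁, p₂, hp⟩ := hcond
  have hsep : (f.map w).Separable := by
    refine ⟨Polynomial.C ((w ⟨d, hd.mem C⟩)⁻¹ ^ n) * p₂.map w,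
      Polynomial.C ((w ⟨d, hd.mem C⟩)⁻¹ ^ n) * p₁.map w, ?_⟩
    have h1 := congrArg (Polynomial.map w) hp
    rw [Polynomial.map_add, Polynomial.map_mul, Polynomial.map_mul, Polynomial.map_pow,
      Polynomial.map_C, ← derivative_map] at h1
    calc _ = Polynomial.C ((w ⟨d, hd.mem C⟩)⁻¹ ^ n) *
          (derivative (f.map w) * p₁.map w + f.map w * p₂.map w) := by ring
      _ = 1 := by rw [h1, ← C_pow, ← C_mul, ← mul_pow, inv_mul_cancel₀ hw, one_pow, C_1]
  obtain ⟨t, ht⟩ := IsSepClosed.exists_root (f.map w) (fun h0 => hf0 (by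
    rw [← hf.natDegree_map w]; exact natDegree_eq_of_degree_eq_some h0)) hsep
  have hmap : Q.HasMap t := by
    refine ⟨?_, ?_⟩
    · rw [hQf, aeval_def, ← Polynomial.eval_map]
      exact ht
    · rw [hQg, aeval_C]
      exact isUnit_iff_ne_zero.mpr hw
  let ψ : Localization.Away d →ₐ[invariants P C] Ω := (Q.lift t hmap).comp Q.equivRing.toAlgHom
  refine ⟨(ψ : Localization.Away d →+* Ω).comp (algebraMap P (Localization.Away d)), fun p => ?_⟩
  exact ψ.commutes p

/-- Two points of `P` with values in a domain, at which `d` does not vanish and which agree on `P ^ C`,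
are conjugate under `C`. -/
theorem exists_smul_of_eq (C : Subgroup Γ) {Ω : Type*} [CommRing Ω] [IsDomain Ω]
    (w w' : P →+* Ω) (hw : w d ≠ 0) (h : ∀ p ∈ invariants P C, w' p = w p) :
    ∃ c ∈ C, ∀ p, w' p = w (c • p) := by
  classical
  obtain ⟨x, hx, hxd⟩ := hd.exists_stabilizer ⊥
  obtain ⟨f, -, -, ⟨Q, hQ⟩, hfx, -, n, -, hgen⟩ := exists_monic_of_forall_sub_dvd C x
    (⟨d, hd.mem C⟩ : invariants P C) (fun h0 => hd.ne_zero congr($h0.1)) fun g hg => hxd g hg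
  have key : ∀ (N : (invariants P C)[X]) (v : P →+* Ω), (∀ p ∈ invariants P C, v p = w p) →
      v (aeval x N) = N.eval₂ (w.comp (invariants P C).subtype) (v x) := by
    intro N v hv
    rw [aeval_def, hom_eval₂]
    congr 1
    ext p
    exact hv p p.2
  have h0 : f.eval₂ (w.comp (invariants P C).subtype) (w' x) = 0 := by
    rw [← key f w' h, hfx, map_zero]
  have h1 : f.map (w.comp (invariants P C).subtype) =
      ∏ g ∈ Q, (X - Polynomial.C (w (g • x))) := by
    rw [← Polynomial.map_map]
    erw [hQ]
    simp [Polynomial.map_prod]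
  rw [← Polynomial.eval_map, h1, eval_prod, Finset.prod_eq_zero_iff] at h0
  obtain ⟨c, -, hc⟩ := h0
  rw [eval_sub, eval_X, eval_C, sub_eq_zero] at hc
  refine ⟨c, c.2, fun r => ?_⟩
  obtain ⟨N, hN⟩ := hgen r fun g hg => by
    have : (g : Γ) = 1 := Subgroup.mem_bot.mp ((hx g).mp hg)
    change (g : Γ) • r = r
    rw [this, one_smul]
  have hv : ∀ p ∈ invariants P C, (w.comp (MulSemiringAction.toRingHom Γ P c)) p = w p := by
    intro p hp
    exact congrArg w (mem_invariants.mp hp c c.2)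
  have e1 := key N w' h
  have e2 := key N _ hv
  rw [hN, map_mul, map_pow] at e1 e2
  have e3 : w' (algebraMap (invariants P C) P ⟨d, hd.mem C⟩) = w d := h d (hd.mem C)
  have e4 := hv d (hd.mem C)
  change w' r * w' (algebraMap (invariants P C) P ⟨d, hd.mem C⟩) ^ n = _ at e1
  change w (c • r) * (w.comp (MulSemiringAction.toRingHom Γ P c)) d ^ n =
    eval₂ _ (w (c • x)) N at e2
  rw [e3] at e1
  rw [e4] at e2
  apply mul_right_cancel₀ (pow_ne_zero n hw)
  rw [e1, hc]
  exact e2.symm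

omit [Finite Γ] [IsDomain P] in
/-- The group `Γ` acts freely on the points of `P` at which `d` does not vanish. -/
theorem eq_of_forall_smul_eq {Ω : Type*} [CommRing Ω]
    (w : P →+* Ω) (hw : w d ≠ 0) {g g' : Γ} (h : ∀ p, w (g • p) = w (g' • p)) : g = g' := by
  obtain ⟨x, hx, hxd⟩ := hd.exists_stabilizer ⊥
  by_contra hne
  obtain ⟨y, hy⟩ := hxd (g'⁻¹ * g) fun h1 => by
    have := Subgroup.mem_bot.mp ((hx _).mp h1)
    exact hne (inv_mul_eq_one.mp this).symm
  apply hw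
  have h2 : d = (g • x - g' • x) * g' • y := by
    conv_lhs => rw [← hd.smul_eq g', hy, smul_mul', smul_sub, smul_smul, mul_inv_cancel_left]
  rw [h2, map_mul, map_sub, h, sub_self, zero_mul]

end IsSeparating

/-- If `z` has trivial stabilizer, each subgroup `C` is the stabilizer of a value of the polynomial
`∏ (T - c • z)`, `c ∈ C`, at an invariant element. -/
theorem exists_stabilizer_eq [Finite Γ] [IsDomain P] (z : P) (hz : ∀ g : Γ, g • z = z → g = 1)
    (hinf : (invariants P (⊤ : Subgroup Γ) : Set P).Infinite) (C : Subgroup Γ) :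
    ∃ x : P, ∀ g : Γ, g • x = x ↔ g ∈ C := by
  classical
  have := Fintype.ofFinite Γ
  let F : P[X] := ∏ c : C, (X - Polynomial.C (c • z))
  have hF : ∀ g ∈ C, g • F = F := by
    intro g hg
    rw [Finset.smul_prod']
    refine Fintype.prod_bijective ((⟨g, hg⟩ : C) * ·) (Group.mulLeft_bijective _) _ _ fun c => ?_
    rw [smul_sub, Polynomial.smul_X, Polynomial.smul_C, mul_smul]
    rfl
  have hF' : ∀ g : Γ, g ∉ C → F - g • F ≠ 0 := by
    intro g hg h0
    have h1 : (g • F).eval (g • z) = 0 := by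
      rw [smul_eval_smul, eval_prod, Finset.prod_eq_zero (Finset.mem_univ (1 : C)) (by simp),
        smul_zero]
    rw [← sub_eq_zero.mp h0, eval_prod, Finset.prod_eq_zero_iff] at h1
    obtain ⟨c, -, hc⟩ := h1
    rw [eval_sub, eval_X, eval_C, sub_eq_zero] at hc
    have h2 : (c : Γ)⁻¹ * g = 1 := hz _ (by rw [mul_smul, hc]; exact inv_smul_smul (c : Γ) z)
    rw [← inv_mul_eq_one.mp h2] at hg
    exact hg c.2
  have hH : ∏ g ∈ Finset.univ.filter (· ∉ C), (F - g • F) ≠ 0 :=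
    Finset.prod_ne_zero_iff.mpr fun g hg => hF' g (Finset.mem_filter.mp hg).2
  obtain ⟨t, ht, htH⟩ := hinf.exists_notMem_finset
    (∏ g ∈ Finset.univ.filter (· ∉ C), (F - g • F)).roots.toFinset
  rw [Multiset.mem_toFinset, mem_roots hH, IsRoot.def, eval_prod, Finset.prod_eq_zero_iff] at htH
  have hgt : ∀ g : Γ, g • F.eval t = (g • F).eval t := fun g => by
    rw [← smul_eval_smul, mem_invariants.mp ht g trivial]
  refine ⟨F.eval t, fun g => ⟨fun hg => ?_, fun hg => by rw [hgt, hF g hg]⟩⟩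
  by_contra hgC
  refine htH ⟨g, by simpa using hgC, ?_⟩
  rw [eval_sub, ← hgt, hg, sub_self]

/-- For each subgroup choose an element of which it is the stabilizer; the product of all differences of
distinct conjugates of these elements is separating. -/
theorem exists_isSeparating [Finite Γ] [IsDomain P] (z : P) (hz : ∀ g : Γ, g • z = z → g = 1)
    (hinf : (invariants P (⊤ : Subgroup Γ) : Set P).Infinite) : ∃ d : P, IsSeparating Γ d := by
  classical
  have := Fintype.ofFinite Γ
  choose x hx using exists_stabilizer_eq z hz hinf
  let S : Subgroup Γ → Finset (Γ × Γ) := fun C =>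
    Finset.univ.filter fun q => q.1 • x C ≠ q.2 • x C
  refine ⟨∏ C : Subgroup Γ, ∏ q ∈ S C, (q.1 • x C - q.2 • x C), fun k => ?_, ?_, fun C =>
    ⟨x C, hx C, fun g hg => ?_⟩⟩
  · rw [Finset.smul_prod']
    refine Finset.prod_congr rfl fun C _ => ?_
    rw [Finset.smul_prod']
    refine Finset.prod_bij (fun q _ => (k * q.1, k * q.2)) ?_ ?_ ?_ ?_
    · intro q hq
      simpa [S, mul_smul] using hq
    · intro q _ q' _ h
      simpa [Prod.ext_iff] using h
    · intro q hq
      exact ⟨(k⁻¹ * q.1, k⁻¹ * q.2), by simpa [S, mul_smul] using hq, by simp⟩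
    · intro q _
      rw [smul_sub, mul_smul, mul_smul]
  · exact Finset.prod_ne_zero_iff.mpr fun C _ => Finset.prod_ne_zero_iff.mpr fun q hq =>
      sub_ne_zero.mpr (Finset.mem_filter.mp hq).2
  · refine dvd_trans ?_ (Finset.dvd_prod_of_mem _ (Finset.mem_univ C))
    have := Finset.dvd_prod_of_mem (fun q : Γ × Γ => q.1 • x C - q.2 • x C)
      (show (g, 1) ∈ S C by simpa [S] using hg)
    simpa using this

end Invariants

/-! ### The twisted action on a polynomial ring -/

section TwistedAction

open MvPolynomial

variable {A B L : Type*} [Group A] [Field L] [MulSemiringAction A L]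

/-- The action of `A × Perm B` on the polynomial ring `L[X_b : b ∈ B]`: the factor `A` acts on the
coefficients and `Perm B` permutes the variables. -/
noncomputable instance twistedAction : MulSemiringAction (A × Equiv.Perm B) (MvPolynomial B L) where
  smul g p := rename g.2 (map (MulSemiringAction.toRingHom A L g.1) p)
  one_smul p := by
    change rename _ (map _ p) = p
    have : MulSemiringAction.toRingHom A L 1 = RingHom.id L := by ext; simp
    rw [Prod.fst_one, this, map_id, Prod.snd_one, Equiv.Perm.coe_one, rename_id_apply]
  mul_smul g h p := by
    change rename _ (map _ p) = rename _ (map _ (rename _ (map _ p)))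
    rw [map_rename, rename_rename, map_map]
    have : MulSemiringAction.toRingHom A L (g * h).1 =
        (MulSemiringAction.toRingHom A L g.1).comp (MulSemiringAction.toRingHom A L h.1) := by
      ext; simp [mul_smul]
    rw [this]
    rfl
  smul_zero g := by
    change rename _ (map _ _) = _
    simp
  smul_add g p q := by
    change rename _ (map _ _) = rename _ (map _ _) + rename _ (map _ _)
    simp
  smul_one g := by
    change rename _ (map _ _) = _
    simp
  smul_mul g p q := by
    change rename _ (map _ _) = rename _ (map _ _) * rename _ (map _ _)
    simp

theorem twisted_smul_def (g : A × Equiv.Perm B) (p : MvPolynomial B L) :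
    g • p = rename g.2 (map (MulSemiringAction.toRingHom A L g.1) p) := rfl

@[simp]
theorem twisted_smul_C (g : A × Equiv.Perm B) (l : L) :
    g • (C l : MvPolynomial B L) = C (g.1 • l) := by
  simp [twisted_smul_def]

@[simp]
theorem twisted_smul_X (g : A × Equiv.Perm B) (b : B) :
    g • (X b : MvPolynomial B L) = X (g.2 b) := by
  simp [twisted_smul_def]

/-- If `l` has no nontrivial stabilizer in `A`, the polynomial `l + ∑ X_b ^ e(b)` with distinct exponents
`e(b) ≥ 1` has no nontrivial stabilizer in `A × Perm B`. -/
theorem exists_stabilizer_eq_one [Finite B] (l : L) (hl : ∀ a : A, a • l = l → a = 1) :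
    ∃ z : MvPolynomial B L, ∀ g : A × Equiv.Perm B, g • z = z → g = 1 := by
  classical
  have := Fintype.ofFinite B
  let e := Fintype.equivFin B
  let z : MvPolynomial B L := C l + ∑ b, X b ^ ((e b : ℕ) + 1)
  refine ⟨z, fun g hg => ?_⟩
  have hz : g • z = C (g.1 • l) + ∑ b, X (g.2 b) ^ ((e b : ℕ) + 1) := by
    simp only [z, smul_add, twisted_smul_C, Finset.smul_sum, smul_pow', twisted_smul_X]
  rw [hz] at hg
  have h1 : g.1 = 1 := by
    apply hl
    have := congrArg (constantCoeff (R := L) (σ := B)) hg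
    simpa [z] using this
  have h2 : g.2 = 1 := by
    ext b
    have := congrArg (coeff (Finsupp.single (g.2 b) ((e b : ℕ) + 1))) hg
    have hne : ¬ (0 : B →₀ ℕ) = Finsupp.single (g.2 b) ((e b : ℕ) + 1) := by
      intro h
      have := DFunLike.congr_fun h (g.2 b)
      simp at this
    simp only [z, coeff_add, coeff_C, if_neg hne, zero_add, coeff_sum, coeff_X_pow] at this
    rw [Finset.sum_eq_single b] at this
    · rw [if_pos rfl] at this
      obtain ⟨b', -, hb'⟩ := Finset.exists_ne_zero_of_sum_ne_zero (this ▸ one_ne_zero)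
      have h3 := (ite_ne_right_iff.mp hb').1
      have h4 := (Finsupp.single_eq_single_iff _ _ _ _).mp h3
      rcases h4 with ⟨h5, h6⟩ | ⟨h5, -⟩
      · have : b' = b := e.injective (Fin.ext (by omega))
        simpa [this] using h5.symm
      · simp at h5
    · intro b' _ hb'
      refine if_neg fun h => hb' ?_
      rcases (Finsupp.single_eq_single_iff _ _ _ _).mp h with ⟨h5, -⟩ | ⟨h5, -⟩
      · exact g.2.injective h5
      · simp at h5
    · simp
  exact Prod.ext h1 h2

/-- The invariants of the full group `A × Perm B` are the polynomials in the elementary symmetric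
functions with coefficients in the fixed field `K` of `A`. -/
theorem exists_ringHom_range_eq_invariants {K : Type*} [Field K] [Algebra K L] [Fintype B]
    (hfix : ∀ l : L, (∀ a : A, a • l = l) ↔ l ∈ Set.range (algebraMap K L)) :
    ∃ φ : MvPolynomial (Fin (Fintype.card B)) K →+* MvPolynomial B L, Function.Injective φ ∧
      (∀ a, φ (C a) = C (algebraMap K L a)) ∧
      φ.range = invariants (MvPolynomial B L) (⊤ : Subgroup (A × Equiv.Perm B)) := by
  let ψ := esymmAlgEquiv (n := Fintype.card B) B K rfl
  have hinj : Function.Injective (map (σ := B) (algebraMap K L)) :=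
    map_injective _ (algebraMap K L).injective
  refine ⟨((map (algebraMap K L)).comp (symmetricSubalgebra B K).val.toRingHom).comp
    ψ.toAlgHom.toRingHom, ?_, ?_, ?_⟩
  · exact (hinj.comp Subtype.val_injective).comp ψ.injective
  · intro a
    change MvPolynomial.map _ (ψ (C a)).1 = _
    have : ψ (C a) = algebraMap K _ a := ψ.commutes a
    rw [this]
    exact map_C _ _
  · ext p
    constructor
    · rintro ⟨q, rfl⟩
      refine mem_invariants.mpr fun g _ => ?_
      change g • MvPolynomial.map _ (ψ q).1 = MvPolynomial.map _ (ψ q).1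
      have h1 : ∀ σ : Equiv.Perm B, rename σ (ψ q).1 = (ψ q).1 := (ψ q).2
      rw [twisted_smul_def, map_map]
      have : (MulSemiringAction.toRingHom A L g.1).comp (algebraMap K L) = algebraMap K L := by
        ext a
        exact (hfix _).mpr ⟨a, rfl⟩ g.1
      rw [this, ← map_rename, h1]
    · intro hp
      have hp' := mem_invariants.mp hp
      have hcoeff : p ∈ Set.range (map (σ := B) (algebraMap K L)) := by
        rw [mem_range_map_iff_coeffs_subset]
        rintro _ hc
        obtain ⟨m, hm, rfl⟩ := mem_coeffs_iff.mp hc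
        refine (hfix _).mp fun a => ?_
        have := congrArg (coeff m) (hp' (a, 1) trivial)
        rw [twisted_smul_def] at this
        simp only [Equiv.Perm.coe_one, rename_id_apply, coeff_map] at this
        exact this
      obtain ⟨q, rfl⟩ := hcoeff
      have hq : q.IsSymmetric := by
        intro σ
        apply hinj
        rw [map_rename]
        have := hp' (1, σ) trivial
        rw [twisted_smul_def] at this
        have h1 : MulSemiringAction.toRingHom A L 1 = RingHom.id L := by ext; simp
        rwa [h1, map_id] at this
      exact ⟨ψ.symm ⟨q, hq⟩, by
        change MvPolynomial.map _ (ψ (ψ.symm ⟨q, hq⟩)).1 = _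
        rw [AlgEquiv.apply_symm_apply]⟩

variable (B L) in
/-- The homomorphism from a field of coefficients fixed by `D` to the invariants of `D` in
`L[X_b : b ∈ B]`. -/
noncomputable def coeffHom (F : Type*) [Field F] [Algebra F L] (D : Subgroup (A × Equiv.Perm B))
    (hD : ∀ g ∈ D, ∀ a : F, g.1 • algebraMap F L a = algebraMap F L a) :
    F →+* invariants (MvPolynomial B L) D :=
  (C.comp (algebraMap F L)).codRestrict _ fun a => mem_invariants.mpr fun g hg => by
    rw [RingHom.comp_apply, twisted_smul_C, hD g hg]

theorem exists_isSeparating_mvPolynomial {K : Type*} [Field K] [Algebra K L] [Finite A] [Finite B]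
    [Nonempty B] (hfix : ∀ l : L, (∀ a : A, a • l = l) ↔ l ∈ Set.range (algebraMap K L))
    (l : L) (hl : ∀ a : A, a • l = l → a = 1) :
    ∃ d : MvPolynomial B L, IsSeparating (A × Equiv.Perm B) d := by
  have := Fintype.ofFinite B
  obtain ⟨z, hz⟩ := exists_stabilizer_eq_one (B := B) l hl
  refine exists_isSeparating z hz ?_
  obtain ⟨φ, hφ, -, hr⟩ := exists_ringHom_range_eq_invariants (B := B) hfix
  rw [← hr]
  have : Nonempty (Fin (Fintype.card B)) := ⟨⟨0, Fintype.card_pos⟩⟩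
  exact Set.infinite_range_of_injective hφ

/-- The invariants of the full group are a polynomial ring over `K`, hence smooth. -/
theorem smooth_coeffHom {K : Type*} [Field K] [Algebra K L] [Finite B]
    (hfix : ∀ l : L, (∀ a : A, a • l = l) ↔ l ∈ Set.range (algebraMap K L)) :
    (coeffHom B L K (⊤ : Subgroup (A × Equiv.Perm B))
      fun g _ a => (hfix _).mpr ⟨a, rfl⟩ g.1).Smooth := by
  have := Fintype.ofFinite B
  obtain ⟨φ, hφ, hC, hr⟩ := exists_ringHom_range_eq_invariants (B := B) hfix
  let e : MvPolynomial (Fin (Fintype.card B)) K ≃+*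
      invariants (MvPolynomial B L) (⊤ : Subgroup (A × Equiv.Perm B)) :=
    (RingEquiv.ofBijective φ.rangeRestrict
      ⟨fun x y h => hφ (congrArg Subtype.val h), φ.rangeRestrict_surjective⟩).trans
      (RingEquiv.subringCongr hr)
  have h1 : (algebraMap K (MvPolynomial (Fin (Fintype.card B)) K)).Smooth :=
    RingHom.smooth_algebraMap.mpr ⟨inferInstance, inferInstance⟩
  have h2 : (e.toRingHom.comp (algebraMap K (MvPolynomial (Fin (Fintype.card B)) K))).Smooth :=
    h1.comp (RingHom.Smooth.of_bijective e.bijective)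
  convert h2 using 1
  ext a
  exact congrArg (coeff _) (hC a).symm

end TwistedAction

/-! ### Geometric integrality of the invariant rings -/

section GeometricallyIntegral

open MvPolynomial TensorProduct

/-- An `F`-algebra which over an algebraic extension `L` of `F` embeds in a polynomial ring is
geometrically integral: over an algebraic closure of `Ω`, which contains `L`, it embeds in a polynomial
ring as well. -/
theorem isDomain_tensorProduct_of_injective {F L M B : Type*} [Field F] [Field L] [Algebra F L]
    [Algebra.IsAlgebraic F L] [CommRing M] [Algebra F M] (ψ : M →ₐ[F] MvPolynomial B L)
    (hψ : Function.Injective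
      (Algebra.TensorProduct.lift (Algebra.ofId L (MvPolynomial B L)) ψ fun _ _ => .all _ _ :
        L ⊗[F] M →ₐ[L] MvPolynomial B L))
    (Ω : Type*) [Field Ω] [Algebra F Ω] : IsDomain (Ω ⊗[F] M) := by
  let Ω' := AlgebraicClosure Ω
  let j : L →ₐ[F] Ω' := IsAlgClosed.lift
  let : Algebra L Ω' := j.toAlgebra
  have : IsScalarTower F L Ω' := .of_algebraMap_eq' j.comp_algebraMap.symm
  let φ₁ : Ω ⊗[F] M →ₐ[F] Ω' ⊗[F] M :=
    Algebra.TensorProduct.map (IsScalarTower.toAlgHom F Ω Ω') (AlgHom.id F M)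
  have h₁ : Function.Injective φ₁ :=
    Module.Flat.rTensor_preserves_injective_linearMap (M := M)
      (IsScalarTower.toAlgHom F Ω Ω').toLinearMap (IsScalarTower.toAlgHom F Ω Ω').injective
  let φ₂ := (Algebra.TensorProduct.cancelBaseChange F L L Ω' M).symm
  let φ₃ : Ω' ⊗[L] (L ⊗[F] M) →ₐ[L] Ω' ⊗[L] MvPolynomial B L :=
    Algebra.TensorProduct.map (AlgHom.id L Ω')
      (Algebra.TensorProduct.lift (Algebra.ofId L (MvPolynomial B L)) ψ fun _ _ => .all _ _)
  have h₃ : Function.Injective φ₃ :=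
    Module.Flat.lTensor_preserves_injective_linearMap (M := Ω')
      (Algebra.TensorProduct.lift (Algebra.ofId L (MvPolynomial B L)) ψ
        fun _ _ => .all _ _).toLinearMap hψ
  let φ₄ := algebraTensorAlgEquiv (σ := B) L Ω'
  let φ : Ω ⊗[F] M →+* MvPolynomial B Ω' := φ₄.toAlgHom.toRingHom.comp
    (φ₃.toRingHom.comp (φ₂.toAlgHom.toRingHom.comp φ₁.toRingHom))
  have h : Function.Injective φ := φ₄.injective.comp (h₃.comp (φ₂.injective.comp h₁))
  exact h.isDomain φ

variable {A B L : Type*} [Group A] [Field L] [MulSemiringAction A L]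
  {D : Subgroup (A × Equiv.Perm B)} {F : Type*} [Field F] [Algebra F L]

/-- Vectors of `L` which are linearly independent over the fixed field of `D` have linearly
independent tuples of conjugates. -/
theorem eq_zero_of_forall_sum_mul_smul_eq_zero
    (hF : ∀ l : L, (∀ g ∈ D, g.1 • l = l) → l ∈ Set.range (algebraMap F L)) {ι : Type*} [Fintype ι]
    {v : ι → L} (hv : LinearIndependent F v) (c : ι → L)
    (h : ∀ g ∈ D, ∑ i, c i * g.1 • v i = 0) : c = 0 := by
  classical
  let : MulSemiringAction D L := MulSemiringAction.compHom L ((MonoidHom.fst A _).comp D.subtype)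
  have h1 : LinearIndependent (FixedPoints.subfield D L) v := by
    rw [Fintype.linearIndependent_iff]
    intro a ha
    choose a' ha' using fun i => hF (a i : L) fun g hg => (a i).2 ⟨g, hg⟩
    have : ∀ i, a' i = 0 := by
      refine Fintype.linearIndependent_iff.mp hv a' ?_
      rw [← ha]
      refine Finset.sum_congr rfl fun i _ => ?_
      rw [Algebra.smul_def, ha']
      rfl
    intro i
    apply Subtype.ext
    rw [← ha' i, this i, map_zero]
    rfl
  have h2 : LinearIndepOn (FixedPoints.subfield D L) id
      ((Finset.univ.image v : Finset L) : Set L) := by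
    rw [Finset.coe_image, Finset.coe_univ, Set.image_univ]
    exact h1.linearIndepOn_id
  have h3 := FixedPoints.linearIndependent_smul_of_linearIndependent D L h2
  have h4 : LinearIndependent L (fun i => MulAction.toFun D L (v i)) :=
    h3.comp (fun i => ⟨v i, by simp⟩) fun i j hij => h1.injective congr($hij.1)
  funext i
  refine Fintype.linearIndependent_iff.mp h4 c ?_ i
  ext ⟨g, hg⟩
  rw [Finset.sum_apply]
  exact h g hg

/-- The map `L ⊗ P ^ D → P` is injective, where `P` is the polynomial ring over `L` and the tensor
product is taken over the fixed field of `D`. -/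
theorem injective_lift_invariants [FiniteDimensional F L]
    [Algebra F (invariants (MvPolynomial B L) D)]
    (ψ : invariants (MvPolynomial B L) D →ₐ[F] MvPolynomial B L) (hψ : ∀ p, ψ p = p)
    (hF : ∀ l : L, (∀ g ∈ D, g.1 • l = l) → l ∈ Set.range (algebraMap F L)) :
    Function.Injective
      (Algebra.TensorProduct.lift (Algebra.ofId L (MvPolynomial B L)) ψ fun _ _ => .all _ _ :
        L ⊗[F] invariants (MvPolynomial B L) D →ₐ[L] MvPolynomial B L) := by
  rw [injective_iff_map_eq_zero]
  intro x hx
  let ℬ := Module.finBasis F L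
  obtain ⟨n, rfl⟩ := TensorProduct.eq_repr_basis_left ℬ x
  have h0 : ∑ i, C (ℬ i) * (n i : MvPolynomial B L) = 0 := by
    rw [← hx, Finsupp.sum_fintype _ _ (by simp), map_sum]
    refine Finset.sum_congr rfl fun i _ => ?_
    rw [Algebra.TensorProduct.lift_tmul, hψ]
    rfl
  have h1 : ∀ i, n i = 0 := by
    intro i
    apply Subtype.ext
    ext m
    refine congr_fun (eq_zero_of_forall_sum_mul_smul_eq_zero (D := D) hF ℬ.linearIndependent
      (fun i => coeff m (n i : MvPolynomial B L)) fun g hg => ?_) i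
    have := congrArg (fun p => coeff m (g • p)) h0
    simp only [Finset.smul_sum, smul_mul', twisted_smul_C, smul_zero, coeff_zero, coeff_sum] at this
    rw [← this]
    refine Finset.sum_congr rfl fun j _ => ?_
    rw [mem_invariants.mp (n j).2 g hg, coeff_C_mul, mul_comm]
  have : n = 0 := Finsupp.ext h1
  rw [this, Finsupp.sum_zero_index]

theorem isDomain_tensorProduct_localization [FiniteDimensional F L]
    (hD : ∀ g ∈ D, ∀ a : F, g.1 • algebraMap F L a = algebraMap F L a)
    (hF : ∀ l : L, (∀ g ∈ D, g.1 • l = l) → l ∈ Set.range (algebraMap F L))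
    (d : invariants (MvPolynomial B L) D) (hd : d ≠ 0)
    (R : Type*) [CommRing R] [Algebra (invariants (MvPolynomial B L) D) R] [IsLocalization.Away d R]
    [Algebra F R] (hR : algebraMap F R = (algebraMap _ R).comp (coeffHom B L F D hD))
    (Ω : Type*) [Field Ω] [Algebra F Ω] : IsDomain (Ω ⊗[F] R) := by
  let : Algebra F (invariants (MvPolynomial B L) D) := (coeffHom B L F D hD).toAlgebra
  have : IsScalarTower F (invariants (MvPolynomial B L) D) R := .of_algebraMap_eq' hR
  let ψ : invariants (MvPolynomial B L) D →ₐ[F] MvPolynomial B L :=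
    { (invariants (MvPolynomial B L) D).subtype with commutes' := fun a => rfl }
  have h1 : IsDomain (Ω ⊗[F] invariants (MvPolynomial B L) D) :=
    isDomain_tensorProduct_of_injective ψ
      (injective_lift_invariants ψ (fun _ => rfl) hF) Ω
  let φ : Ω ⊗[F] invariants (MvPolynomial B L) D →ₐ[Ω] Ω ⊗[F] R :=
    Algebra.TensorProduct.map (AlgHom.id Ω Ω)
      (IsScalarTower.toAlgHom F (invariants (MvPolynomial B L) D) R)
  let : Algebra (Ω ⊗[F] invariants (MvPolynomial B L) D) (Ω ⊗[F] R) := φ.toAlgebra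
  have : IsScalarTower Ω (Ω ⊗[F] invariants (MvPolynomial B L) D) (Ω ⊗[F] R) :=
    .of_algebraMap_eq' φ.comp_algebraMap.symm
  have h2 := IsLocalization.tensorProduct_tensorProduct_right F Ω (.powers d) R (by
    ext x
    change φ (1 ⊗ₜ x) = 1 ⊗ₜ _
    rw [Algebra.TensorProduct.map_tmul]
    rfl)
  refine IsLocalization.isDomain_of_le_nonZeroDivisors
    (R := Ω ⊗[F] invariants (MvPolynomial B L) D) (S := Ω ⊗[F] R)
    (M := (Submonoid.powers d).map (Algebra.TensorProduct.includeRight (R := F) (A := Ω))) ?_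
  rintro _ ⟨_, ⟨k, rfl⟩, rfl⟩
  refine mem_nonZeroDivisors_of_ne_zero ?_
  rw [map_pow]
  refine pow_ne_zero _ ?_
  have : Function.Injective (Algebra.TensorProduct.includeRight (R := F) (A := Ω)
    (B := invariants (MvPolynomial B L) D)) :=
      Algebra.TensorProduct.includeRight_injective (algebraMap F Ω).injective
  simpa using this.ne hd

end GeometricallyIntegral

/-! ### Krull dimension of the invariant rings -/

section Dimension

open MvPolynomial

theorem comap_lt_comap_of_isIntegral {R S : Type*} [CommRing R] [CommRing S] (f : R →+* S)
    (hf : f.IsIntegral) {I J : Ideal S} [I.IsPrime] (h : I < J) : I.comap f < J.comap f := by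
  let := f.toAlgebra
  obtain ⟨hle, x, hx⟩ := SetLike.lt_iff_le_and_exists.mp h
  exact Ideal.comap_lt_comap_of_integral_mem_sdiff hle hx (hf x)

/-- The kernels of the successive specializations of the variables at a point `c` over the
algebraic closure with `d(c) ≠ 0` form a chain of primes avoiding `d`. -/
theorem exists_strictMono_prime_notMem {L B : Type*} [Field L] [Finite B] (d : MvPolynomial B L)
    (hd : d ≠ 0) : ∃ p : Fin (Nat.card B + 1) → Ideal (MvPolynomial B L),
      StrictMono p ∧ ∀ k, (p k).IsPrime ∧ d ∉ p k := by
  let M := AlgebraicClosure L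
  have hinj : Function.Injective (map (σ := B) (algebraMap L M)) :=
    map_injective _ (algebraMap L M).injective
  obtain ⟨c, hc⟩ : ∃ c : B → M, eval c (map (algebraMap L M) d) ≠ 0 := by
    by_contra! h
    refine hd (hinj ?_)
    rw [map_zero]
    exact MvPolynomial.funext fun x => by rw [h, map_zero]
  let e := Finite.equivFin B
  let η (k : ℕ) : MvPolynomial B L →ₐ[L] MvPolynomial B M :=
    aeval fun b => if (e b : ℕ) < k then C (c b) else X b
  let π (k : ℕ) : MvPolynomial B M →ₐ[L] MvPolynomial B M :=
    (aeval (R := M) fun b => if (e b : ℕ) < k then C (c b) else X b).restrictScalars L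
  have hπ : ∀ k k', k ≤ k' → (π k').comp (η k) = η k' := by
    intro k k' h
    ext1 b
    by_cases h1 : (e b : ℕ) < k
    · simp [η, π, h1, h1.trans_le h, algebraMap_eq]
    · simp [η, π, h1]
  have hmono : ∀ k k', k ≤ k' → RingHom.ker (η k) ≤ RingHom.ker (η k') := by
    intro k k' h x hx
    rw [RingHom.mem_ker] at hx ⊢
    rw [← hπ k k' h, AlgHom.comp_apply, hx, map_zero]
  refine ⟨fun k => RingHom.ker (η k), Fin.strictMono_iff_lt_succ.mpr fun k => ?_, fun k =>
    ⟨RingHom.ker_isPrime _, fun h => hc ?_⟩⟩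
  · refine lt_of_le_of_ne (hmono _ _ (by simp)) fun heq => ?_
    let b := e.symm k
    let m : MvPolynomial B L := Polynomial.aeval (X b) (minpoly L (c b))
    have h1 : m ∈ RingHom.ker (η (k.succ : Fin _)) := by
      rw [RingHom.mem_ker, ← Polynomial.aeval_algHom_apply]
      have : η (k.succ : Fin _) (X b) = algebraMap M _ (c b) := by
        simp [η, b, algebraMap_eq]
      rw [this, Polynomial.aeval_algebraMap_apply, minpoly.aeval, map_zero]
    rw [← heq, RingHom.mem_ker, ← Polynomial.aeval_algHom_apply] at h1
    have h2 : η (k.castSucc : Fin _) (X b) = X b := by simp [η, b]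
    rw [h2] at h1
    have h3 := (transcendental_X M b)
    have h4 : Transcendental L (X b : MvPolynomial B M) := h3.restrictScalars
      (algebraMap L M).injective
    exact h4 ⟨_, minpoly.ne_zero (Algebra.IsIntegral.isIntegral (c b)), h1⟩
  · rw [RingHom.mem_ker] at h
    have h1 : (eval c).comp (η k : MvPolynomial B L →+* MvPolynomial B M) =
        (eval c).comp (map (algebraMap L M)) := by
      ext b
      · simp [η]
      · by_cases h1 : (e b : ℕ) < (k : ℕ)
        · simp [η, h1]
        · simp [η, h1]
    have h2 := congrArg (fun f => f d) h1
    simp only [RingHom.comp_apply] at h2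
    rw [← h2]
    change eval c (η k d) = 0
    rw [h, map_zero]

variable {A B L : Type*} [Group A] [Finite A] [Field L] [MulSemiringAction A L] [Finite B]

theorem isIntegral_inclusion_invariants {Γ P : Type*} [Group Γ] [Finite Γ] [CommRing P]
    [MulSemiringAction Γ P] {C D : Subgroup Γ} (h : C ≤ D) :
    (Subring.inclusion (invariants_antitone (P := P) h)).IsIntegral := by
  intro p
  have h1 : Algebra.IsIntegral (invariants P D) P := Algebra.IsInvariant.isIntegral _ _ D
  obtain ⟨f, hf, hfp⟩ := h1.isIntegral (p : P)
  refine ⟨f, hf, Subtype.ext ?_⟩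
  rw [← Subring.coe_subtype, Polynomial.hom_eval₂]
  exact hfp

/-- The dimension is at most that of the polynomial ring of invariants of the full group, over which the
invariants of `D` are integral; a chain of primes of `L[X_b : b ∈ B]` avoiding `d` restricts to one of
the required length. -/
theorem ringKrullDim_localization_invariants {K : Type*} [Field K] [Algebra K L]
    (hfix : ∀ l : L, (∀ a : A, a • l = l) ↔ l ∈ Set.range (algebraMap K L))
    (D : Subgroup (A × Equiv.Perm B)) (d : invariants (MvPolynomial B L) D) (hd : d ≠ 0)
    (R : Type*) [CommRing R] [Algebra (invariants (MvPolynomial B L) D) R]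
    [IsLocalization.Away d R] : ringKrullDim R = Nat.card B := by
  have := Fintype.ofFinite B
  apply le_antisymm
  · obtain ⟨φ, hφ, -, hr⟩ := exists_ringHom_range_eq_invariants (B := B) hfix
    let e : MvPolynomial (Fin (Fintype.card B)) K ≃+*
        invariants (MvPolynomial B L) (⊤ : Subgroup (A × Equiv.Perm B)) :=
      (RingEquiv.ofBijective φ.rangeRestrict
        ⟨fun x y h => hφ (congrArg Subtype.val h), φ.rangeRestrict_surjective⟩).trans
        (RingEquiv.subringCongr hr)
    have h1 : ringKrullDim (invariants (MvPolynomial B L) (⊤ : Subgroup (A × Equiv.Perm B))) =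
        Nat.card B := by
      rw [← ringKrullDim_eq_of_ringEquiv e, MvPolynomial.ringKrullDim_of_isNoetherianRing,
        ringKrullDim_eq_zero_of_field, zero_add]
      simp
    rw [← h1]
    have hint := isIntegral_inclusion_invariants (P := MvPolynomial B L) (le_top (a := D))
    refine Order.krullDim_le_of_strictMono (fun p : PrimeSpectrum R =>
      PrimeSpectrum.comap (Subring.inclusion (invariants_antitone (le_top (a := D))))
        (PrimeSpectrum.comap (algebraMap (invariants (MvPolynomial B L) D) R) p)) fun p q hpq => ?_
    have h2 := (IsLocalization.primeSpectrumOrderIso (.powers d) R).strictMono hpq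
    exact comap_lt_comap_of_isIntegral _ hint
      (I := (PrimeSpectrum.comap (algebraMap (invariants (MvPolynomial B L) D) R) p).asIdeal)
      (J := (PrimeSpectrum.comap (algebraMap (invariants (MvPolynomial B L) D) R) q).asIdeal) h2
  · obtain ⟨p, hp, hpd⟩ := exists_strictMono_prime_notMem (d : MvPolynomial B L)
      fun h => hd (Subtype.ext h)
    have hint : (invariants (MvPolynomial B L) D).subtype.IsIntegral :=
      (Algebra.IsInvariant.isIntegral _ _ D :
        Algebra.IsIntegral (invariants (MvPolynomial B L) D) (MvPolynomial B L)).isIntegral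
    let q : Fin (Nat.card B + 1) → PrimeSpectrum (invariants (MvPolynomial B L) D) := fun k =>
      have := (hpd k).1
      ⟨(p k).comap (invariants (MvPolynomial B L) D).subtype, inferInstance⟩
    have hq : StrictMono q := fun i j hij =>
      have := (hpd i).1
      comap_lt_comap_of_isIntegral _ hint (hp hij)
    have hqd : ∀ k, Disjoint (Submonoid.powers d : Set (invariants (MvPolynomial B L) D))
        (q k).asIdeal := by
      intro k
      rw [Set.disjoint_left]
      rintro _ ⟨m, rfl⟩ hm
      exact (hpd k).2 ((q k).2.mem_of_pow_mem _ hm)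
    let s : LTSeries (PrimeSpectrum R) := LTSeries.mk (Nat.card B)
      (fun k => (IsLocalization.primeSpectrumOrderIso (.powers d) R).symm ⟨q k, hqd k⟩)
      fun i j hij => (IsLocalization.primeSpectrumOrderIso (.powers d) R).symm.strictMono (hq hij)
    exact Order.LTSeries.length_le_krullDim s

end Dimension

/-! ### Galois descent: invariant rings that are polynomial rings -/

section Speiser

open MvPolynomial

variable {A B L : Type*} [Group A] [Finite A] [Field L] [MulSemiringAction A L] [Finite B]
  {D : Subgroup (A × Equiv.Perm B)}

/-- Galois descent for the space of linear forms: if `D` acts faithfully on the coefficient field,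
the invariant vectors span `B → L`. By Dedekind's independence of characters, a linear functional
which vanishes on all averages `∑ g • (l • w)` is zero. -/
theorem span_invariant_vectors_eq_top (hD : ∀ g ∈ D, (∀ l : L, g.1 • l = l) → g = 1) :
    Submodule.span L {w : B → L | ∀ g ∈ D, ∀ b, g.1 • w b = w (g.2 b)} = ⊤ := by
  classical
  have := Fintype.ofFinite D
  by_contra hne
  obtain ⟨f, hf0, hf⟩ := Submodule.exists_le_ker_of_lt_top _ (lt_top_iff_ne_top.mpr hne)
  refine hf0 (LinearMap.ext fun w => ?_)
  let tw (g : D) (w : B → L) : B → L := fun b => g.1.1 • w (g.1.2⁻¹ b)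
  let χ (g : D) : L →* L := MulDistribMulAction.toMonoidHom L g.1.1
  have hχ : Function.Injective χ := by
    intro g h hgh
    have h1 : ∀ l : L, (h⁻¹ * g).1.1 • l = l := by
      intro l
      have : g.1.1 • l = h.1.1 • l := DFunLike.congr_fun hgh l
      change (h.1.1⁻¹ * g.1.1) • l = l
      rw [mul_smul, this, inv_smul_smul]
    have h2 := hD _ (h⁻¹ * g).2 h1
    exact (inv_mul_eq_one.mp (Subtype.ext h2 : h⁻¹ * g = 1)).symm
  have hmem : ∀ w : B → L, f (∑ g, tw g w) = 0 := by
    intro w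
    refine hf (Submodule.subset_span fun k hk b => ?_)
    rw [Finset.sum_apply, Finset.sum_apply, Finset.smul_sum]
    refine Fintype.sum_bijective ((⟨k, hk⟩ : D) * ·) (Group.mulLeft_bijective _) _ _ fun g => ?_
    simp only [tw, smul_smul]
    congr 2
    simp
  have hsum : ∀ l : L, ∑ g, f (tw g w) * χ g l = 0 := by
    intro l
    rw [← hmem (l • w), map_sum]
    refine Finset.sum_congr rfl fun g _ => ?_
    have : tw g (l • w) = (g.1.1 • l) • tw g w := by
      funext b
      simp [tw]
    rw [this, map_smul, smul_eq_mul, mul_comm]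
    rfl
  have hlin := (linearIndependent_monoidHom L L).comp χ hχ
  have := Fintype.linearIndependent_iff.mp hlin (fun g => f (tw g w))
    (by funext l; simpa using hsum l) 1
  change f w = 0
  rw [← this]
  congr 1
  funext b
  simp [tw]
  rfl

/-- The invariants of a group acting faithfully on the coefficient field form a polynomial ring over
the fixed field. -/
theorem exists_ringEquiv_invariants {F : Type*} [Field F] [Algebra F L]
    (hD : ∀ g ∈ D, (∀ l : L, g.1 • l = l) → g = 1)
    (hDF : ∀ g ∈ D, ∀ a : F, g.1 • algebraMap F L a = algebraMap F L a)
    (hF : ∀ l : L, (∀ g ∈ D, g.1 • l = l) → l ∈ Set.range (algebraMap F L)) :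
    ∃ e : MvPolynomial B F ≃+* invariants (MvPolynomial B L) D,
      ∀ a, e (C a) = coeffHom B L F D hDF a := by
  classical
  have := Fintype.ofFinite B
  have hspan := (span_invariant_vectors_eq_top hD).ge
  let v₀ := Module.Basis.ofSpan hspan
  have hv₀ := Module.Basis.ofSpan_subset hspan
  have := Module.Finite.finite_basis v₀
  have hcard : Nat.card _ = Nat.card B :=
    (Module.finrank_eq_nat_card_basis v₀).symm.trans (by simp)
  let v : Module.Basis B L (B → L) := v₀.reindex
    ((Finite.equivFin _).trans ((finCongr hcard).trans (Finite.equivFin B).symm))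
  have hv : ∀ k, ∀ g ∈ D, ∀ b, g.1 • v k b = v k (g.2 b) := fun k =>
    hv₀ ⟨_, (v₀.reindex_apply _ k).symm⟩
  let φ : MvPolynomial B L →ₐ[L] MvPolynomial B L := aeval fun k => ∑ b, C (v k b) * X b
  let ψ : MvPolynomial B L →ₐ[L] MvPolynomial B L :=
    aeval fun b => ∑ k, C (v.repr (Pi.single b 1) k) * X k
  have h1 : ∀ b, ∑ k, v.repr (Pi.single b 1) k • v k = Pi.single b (1 : L) := fun b =>
    v.sum_repr _
  have hlin : ∀ w : B → L, w = ∑ b, w b • Pi.single b (1 : L) := fun w => by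
    funext b
    simp [Pi.single_apply]
  have hφψ : φ.comp ψ = AlgHom.id L _ := by
    ext1 b
    have : φ (ψ (X b)) = ∑ b', C ((∑ k, v.repr (Pi.single b 1) k • v k) b') * X b' := by
      simp only [φ, ψ, aeval_X, map_sum, map_mul, algHom_C, algebraMap_eq, Finset.sum_apply,
        Pi.smul_apply, smul_eq_mul, Finset.mul_sum, Finset.sum_mul, mul_assoc]
      rw [Finset.sum_comm]
    rw [AlgHom.comp_apply, this, h1]
    simp [Pi.single_apply]
  have hψφ : ψ.comp φ = AlgHom.id L _ := by
    ext1 k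
    have : ψ (φ (X k)) = ∑ k', C (v.repr (∑ b, v k b • Pi.single b 1) k') * X k' := by
      simp only [φ, ψ, aeval_X, map_sum, map_mul, algHom_C, algebraMap_eq, map_smul,
        Finsupp.coe_finsetSum, Finsupp.coe_smul, Finset.sum_apply,
        Pi.smul_apply, smul_eq_mul, Finset.mul_sum, Finset.sum_mul, mul_assoc]
      rw [Finset.sum_comm]
    rw [AlgHom.comp_apply, this, ← hlin]
    simp [Finsupp.single_apply]
  let ε : MvPolynomial B L ≃ₐ[L] MvPolynomial B L := AlgEquiv.ofAlgHom φ ψ hφψ hψφ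
  have heq : ∀ g ∈ D, ∀ p, g • ε p = ε (map (MulSemiringAction.toRingHom A L g.1) p) := by
    intro g hg p
    have : (MulSemiringAction.toRingHom (A × Equiv.Perm B) (MvPolynomial B L) g).comp
        (ε : MvPolynomial B L →+* MvPolynomial B L) =
        (ε : MvPolynomial B L →+* MvPolynomial B L).comp
          (map (MulSemiringAction.toRingHom A L g.1)) := by
      refine ringHom_ext' (RingHom.ext fun a => ?_) fun a => ?_
      · simp [ε, algebraMap_eq, φ]
      · have e1 : ε (X a) = ∑ b, C (v a b) * X b := aeval_X _ _
        simp only [RingHom.comp_apply, map_X, RingHom.coe_coe, e1,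
          MulSemiringAction.toRingHom_apply, Finset.smul_sum, smul_mul', twisted_smul_C,
          twisted_smul_X, hv a g hg]
        exact Fintype.sum_bijective g.2 g.2.bijective _ _ fun b => rfl
    exact congrArg (fun f => f p) this
  have hinj : Function.Injective (map (σ := B) (algebraMap F L)) :=
    map_injective _ (algebraMap F L).injective
  let θ : MvPolynomial B F →+* invariants (MvPolynomial B L) D :=
    ((ε : MvPolynomial B L →+* MvPolynomial B L).comp (map (algebraMap F L))).codRestrict _ (by
      intro p
      refine mem_invariants.mpr fun g hg => ?_
      have h2 : (MulSemiringAction.toRingHom A L g.1).comp (algebraMap F L) = algebraMap F L :=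
        RingHom.ext (hDF g hg)
      rw [RingHom.comp_apply, RingHom.coe_coe, heq g hg, map_map, h2])
  refine ⟨RingEquiv.ofBijective θ ⟨fun x y h => ?_, fun y => ?_⟩, fun a => ?_⟩
  · exact hinj (ε.injective (congrArg Subtype.val h))
  · have hmem : ε.symm (y : MvPolynomial B L) ∈ Set.range (map (σ := B) (algebraMap F L)) := by
      rw [mem_range_map_iff_coeffs_subset]
      intro c hc
      obtain ⟨m, hm, rfl⟩ := mem_coeffs_iff.mp hc
      refine hF _ fun g hg => ?_
      have h2 := heq g hg (ε.symm y)
      rw [AlgEquiv.apply_symm_apply, mem_invariants.mp y.2 g hg, ← AlgEquiv.symm_apply_eq] at h2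
      have h3 := congrArg (coeff m) h2
      rw [coeff_map] at h3
      exact h3.symm
    obtain ⟨q, hq⟩ := hmem
    refine ⟨q, Subtype.ext ?_⟩
    change ε (map _ q) = y
    rw [hq, AlgEquiv.apply_symm_apply]
  · apply Subtype.ext
    change ε (map _ (C a)) = C (algebraMap F L a)
    rw [map_C]
    exact ε.commutes _

end Speiser

/-! ### The affine schemes of localized invariants -/

section Schemes

open CommRingCat

variable {A : Type u} {B : Type} {L : Type u} [Group A] [Finite A] [Field L]
  [MulSemiringAction A L] [Finite B] {d : MvPolynomial B L}
  (hd : IsSeparating (A × Equiv.Perm B) d)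

/-- The ring of invariants of `D` in `L[X_b : b ∈ B][1/d]`, as a localization of the ring of
invariants in the polynomial ring. -/
abbrev LocalizedInvariants (D : Subgroup (A × Equiv.Perm B)) : Type u :=
  Localization.Away (⟨d, hd.mem D⟩ : invariants (MvPolynomial B L) D)

/-- The homomorphism from a field `F` of coefficients fixed by `D` to the localized invariants of `D`;
it makes their spectrum an `F`-scheme. -/
noncomputable def structureHom (F : Type u) [Field F] [Algebra F L]
    (D : Subgroup (A × Equiv.Perm B))
    (hD : ∀ g ∈ D, ∀ a : F, g.1 • algebraMap F L a = algebraMap F L a) :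
    F →+* LocalizedInvariants hd D :=
  (algebraMap _ _).comp (coeffHom B L F D hD)

variable {F : Type u} [Field F] [Algebra F L] {D : Subgroup (A × Equiv.Perm B)}
    (hD : ∀ g ∈ D, ∀ a : F, g.1 • algebraMap F L a = algebraMap F L a)

instance isIntegral_isClosedUnderIsomorphisms :
    ObjectProperty.IsClosedUnderIsomorphisms (C := Scheme.{u}) (IsIntegral ·) where
  of_iso e _ :=
    have : Nonempty _ := ⟨e.hom (Nonempty.some inferInstance)⟩
    isIntegral_of_isOpenImmersion e.inv

theorem geometricallyIntegral_structureHom [FiniteDimensional F L]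
    (hF : ∀ l : L, (∀ g ∈ D, g.1 • l = l) → l ∈ Set.range (algebraMap F L)) :
    GeometricallyIntegral (Spec.map (ofHom (structureHom hd F D hD))) := by
  constructor
  rw [geometrically_iff_of_commRing_of_isClosedUnderIsomorphisms]
  intro Ω _ _
  let : Algebra F (LocalizedInvariants hd D) := (structureHom hd F D hD).toAlgebra
  have h1 : IsDomain (TensorProduct F Ω (LocalizedInvariants hd D)) :=
    isDomain_tensorProduct_localization hD hF ⟨d, hd.mem D⟩
      (fun h => hd.ne_zero (congrArg Subtype.val h)) _ rfl Ω
  have h2 : IsDomain (TensorProduct F (LocalizedInvariants hd D) Ω) :=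
    (Algebra.TensorProduct.comm F (LocalizedInvariants hd D) Ω).toMulEquiv.isDomain
  have : Nonempty ↥(Limits.pullback (Spec.map (ofHom (structureHom hd F D hD)))
      (Spec.map (ofHom (algebraMap F Ω)))) :=
    ⟨(pullbackSpecIso F (LocalizedInvariants hd D) Ω).inv (Nonempty.some inferInstance)⟩
  exact isIntegral_of_isOpenImmersion
    (pullbackSpecIso F (LocalizedInvariants hd D) Ω).hom

/-- If `D` acts faithfully on the coefficients, its invariants are a polynomial ring by Galois descent, and
the spectrum of a localization is a dense open subscheme of the affine space. -/
theorem birationalToAffineSpace_structureHom [FiniteDimensional F L]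
    (hinj : ∀ g ∈ D, (∀ l : L, g.1 • l = l) → g = 1)
    (hF : ∀ l : L, (∀ g ∈ D, g.1 • l = l) → l ∈ Set.range (algebraMap F L)) :
    BirationalToAffineSpace (Spec.map (ofHom (structureHom hd F D hD))) (Nat.card B) := by
  obtain ⟨e, he⟩ := exists_ringEquiv_invariants hinj hD hF
  let ρ : ULift.{u} (Fin (Nat.card B)) ≃ B := Equiv.ulift.trans (Finite.equivFin B).symm
  let ε : MvPolynomial (ULift.{u} (Fin (Nat.card B))) F ≃+* invariants (MvPolynomial B L) D :=
    (MvPolynomial.renameEquiv F ρ).toRingEquiv.trans e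
  have hε : ε.toRingHom.comp MvPolynomial.C = coeffHom B L F D hD := by
    ext1 a
    change e (MvPolynomial.rename ρ (MvPolynomial.C a)) = _
    rw [MvPolynomial.rename_C, he]
  let j : Spec (.of (LocalizedInvariants hd D)) ⟶
      𝔸(ULift.{u} (Fin (Nat.card B)); Spec (.of F)) :=
    Spec.map (ofHom (algebraMap (invariants (MvPolynomial B L) D) _)) ≫
      Spec.map ε.toCommRingCatIso.hom ≫ (AffineSpace.SpecIso _ (.of F)).inv
  have hj : j ≫ (𝔸(ULift.{u} (Fin (Nat.card B)); Spec (.of F)) ↘ Spec (.of F)) =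
      Spec.map (ofHom (structureHom hd F D hD)) := by
    simp only [j, Category.assoc]
    rw [AffineSpace.SpecIso_inv_over, ← Spec.map_comp, ← Spec.map_comp]
    congr 1
    ext a
    exact congrArg (algebraMap (invariants (MvPolynomial B L) D) (LocalizedInvariants hd D))
      (DFunLike.congr_fun hε a)
  have hne : Nontrivial (LocalizedInvariants hd D) :=
    (IsLocalization.injective (LocalizedInvariants hd D)
      (M := .powers (⟨d, hd.mem D⟩ : invariants (MvPolynomial B L) D))
      (powers_le_nonZeroDivisors_of_noZeroDivisors
        fun h => hd.ne_zero (congrArg Subtype.val h))).nontrivial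
  refine ⟨⊤, j.opensRange, by simp, ?_, (Scheme.topIso _) ≪≫ j.isoOpensRange, ?_⟩
  · refine j.opensRange.isOpen.dense ?_
    exact ⟨_, Set.mem_range_self (Nonempty.some inferInstance)⟩
  · rw [Iso.trans_hom, Category.assoc, Scheme.Hom.isoOpensRange_hom_ι_assoc, hj]
    rfl

/-- The restriction homomorphism between localized rings of invariants of two subgroups. -/
noncomputable def restrictionHom {C D : Subgroup (A × Equiv.Perm B)} (h : C ≤ D) :
    LocalizedInvariants hd D →+* LocalizedInvariants hd C :=
  IsLocalization.Away.lift (⟨d, hd.mem D⟩ : invariants (MvPolynomial B L) D)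
    (g := (algebraMap (invariants (MvPolynomial B L) C) (LocalizedInvariants hd C)).comp
      (Subring.inclusion (invariants_antitone h)))
    (IsLocalization.Away.algebraMap_isUnit (⟨d, hd.mem C⟩ : invariants (MvPolynomial B L) C))

theorem restrictionHom_comp_algebraMap {C D : Subgroup (A × Equiv.Perm B)} (h : C ≤ D) :
    (restrictionHom hd h).comp (algebraMap (invariants (MvPolynomial B L) D) _) =
      (algebraMap (invariants (MvPolynomial B L) C) (LocalizedInvariants hd C)).comp
        (Subring.inclusion (invariants_antitone h)) :=
  IsLocalization.Away.lift_comp _ _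

/-- The localized invariants of `C` are étale over those of `D`, since both are étale over the invariants
of `D`. -/
theorem etale_restrictionHom {C D : Subgroup (A × Equiv.Perm B)} (h : C ≤ D) :
    Etale (Spec.map (ofHom (restrictionHom hd h))) := by
  have h1 : Etale (Spec.map (ofHom (restrictionHom hd h)) ≫
      Spec.map (ofHom (algebraMap (invariants (MvPolynomial B L) D)
        (LocalizedInvariants hd D)))) := by
    rw [← Spec.map_comp, ← ofHom_comp, restrictionHom_comp_algebraMap,
      HasRingHomProperty.Spec_iff (P := @Etale)]
    exact hd.etale h (LocalizedInvariants hd C)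
  exact Etale.of_comp _ (Spec.map (ofHom (algebraMap (invariants (MvPolynomial B L) D)
    (LocalizedInvariants hd D))))

/-- The localized invariants of `D` are étale over the invariants of the full group, which are a polynomial
ring over the fixed field `K`. -/
theorem smooth_structureHom {K : Type u} [Field K] [Algebra K L]
    (hfix : ∀ l : L, (∀ a : A, a • l = l) ↔ l ∈ Set.range (algebraMap K L))
    (D : Subgroup (A × Equiv.Perm B)) :
    Smooth (Spec.map (ofHom (structureHom hd K D
      fun g _ a => (hfix _).mpr ⟨a, rfl⟩ g.1))) := by
  rw [HasRingHomProperty.Spec_iff (P := @Smooth)]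
  exact (smooth_coeffHom (B := B) hfix).comp
    ((RingHom.etale_iff_formallyUnramified_and_smooth _).mp
      (hd.etale (le_top (a := D)) (LocalizedInvariants hd D))).2

theorem topologicalKrullDim_localizedInvariants {K : Type u} [Field K] [Algebra K L]
    (hfix : ∀ l : L, (∀ a : A, a • l = l) ↔ l ∈ Set.range (algebraMap K L))
    (D : Subgroup (A × Equiv.Perm B)) :
    topologicalKrullDim (Spec (.of (LocalizedInvariants hd D))) = Nat.card B := by
  rw [← ringKrullDim_localization_invariants hfix D ⟨d, hd.mem D⟩
    (fun h => hd.ne_zero (congrArg Subtype.val h)) (LocalizedInvariants hd D)]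
  exact PrimeSpectrum.topologicalKrullDim_eq_ringKrullDim _

end Schemes

/-! ### Unirational arithmetical problems attached to embedding problems -/

section Problem

open CommRingCat

section

variable {A : Type u} {B : Type} {L : Type u} [Group A] [Finite A] [Field L]
  [MulSemiringAction A L] [Finite B] {d : MvPolynomial B L}
  (hd : IsSeparating (A × Equiv.Perm B) d)

variable {K F : Type u} [Field K] [Algebra K L] [Field F] [Algebra F L] [Algebra K F]
  [IsScalarTower K F L] {C D : Subgroup (A × Equiv.Perm B)} (h : C ≤ D)
  (hD : ∀ g ∈ D, ∀ a : K, g.1 • algebraMap K L a = algebraMap K L a)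
  (hC : ∀ g ∈ C, ∀ a : F, g.1 • algebraMap F L a = algebraMap F L a)

theorem structureHom_comp_algebraMap :
    (structureHom hd F C hC).comp (algebraMap K F) =
      (restrictionHom hd h).comp (structureHom hd K D hD) := by
  rw [structureHom, structureHom, ← RingHom.comp_assoc _ _ (restrictionHom hd h),
    restrictionHom_comp_algebraMap, RingHom.comp_assoc, RingHom.comp_assoc]
  congr 1
  ext1 a
  refine Subtype.ext ?_
  change MvPolynomial.C (algebraMap F L (algebraMap K F a)) = MvPolynomial.C (algebraMap K L a)
  rw [← IsScalarTower.algebraMap_apply]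

/-- The étale morphism from the spectrum of the invariants of `C` to the base change to `F` of the
spectrum of the invariants of a larger group `D`. -/
noncomputable def invariantsCover :
    Spec (.of (LocalizedInvariants hd C)) ⟶
      pullback (Spec.map (ofHom (structureHom hd K D hD))) (specAlgebraMap K F) :=
  pullback.lift (Spec.map (ofHom (restrictionHom hd h)))
    (Spec.map (ofHom (structureHom hd F C hC))) (by
      rw [← Spec.map_comp, ← Spec.map_comp, ← ofHom_comp, ← ofHom_comp,
        structureHom_comp_algebraMap hd h hD hC])

theorem etale_specAlgebraMap [FiniteDimensional K F] [Algebra.IsSeparable K F] :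
    Etale (specAlgebraMap K F) := by
  rw [HasRingHomProperty.Spec_iff (P := @Etale)]
  have : Algebra.FormallyEtale K F := .of_isSeparable K F
  have : Algebra.FinitePresentation K F := Algebra.FinitePresentation.of_finiteType.mp inferInstance
  exact RingHom.etale_algebraMap.mpr ⟨inferInstance, inferInstance⟩

theorem etale_invariantsCover [FiniteDimensional K F] [Algebra.IsSeparable K F] :
    Etale (invariantsCover hd h hD hC) := by
  have := etale_specAlgebraMap (K := K) (F := F)
  have : Etale (invariantsCover hd h hD hC ≫ pullback.fst (Spec.map
      (ofHom (structureHom hd K D hD))) (specAlgebraMap K F)) := by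
    rw [invariantsCover, pullback.lift_fst]
    exact etale_restrictionHom hd h
  exact Etale.of_comp _ (pullback.fst (Spec.map
      (ofHom (structureHom hd K D hD))) (specAlgebraMap K F))

theorem isSmoothVariety_structureHom [FiniteDimensional K L]
    (hfix : ∀ l : L, (∀ a : A, a • l = l) ↔ l ∈ Set.range (algebraMap K L))
    (hF : ∀ l : L, (∀ g ∈ D, g.1 • l = l) → l ∈ Set.range (algebraMap K L)) :
    IsSmoothVariety (Spec.map (ofHom (structureHom hd K D hD))) := by
  have := smooth_structureHom hd hfix D
  exact ⟨geometricallyIntegral_structureHom hd hD hF, inferInstance, inferInstance, this⟩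

/-- Smoothness over an intermediate field `F` of `L / K`: the `F`-scheme is étale over the base change to
`F` of a smooth `K`-scheme. -/
theorem isSmoothVariety_structureHom_of_isSeparable [FiniteDimensional K L]
    [FiniteDimensional K F] [Algebra.IsSeparable K F]
    (hfix : ∀ l : L, (∀ a : A, a • l = l) ↔ l ∈ Set.range (algebraMap K L))
    (hF : ∀ l : L, (∀ g ∈ C, g.1 • l = l) → l ∈ Set.range (algebraMap F L)) :
    IsSmoothVariety (Spec.map (ofHom (structureHom hd F C hC))) := by
  have hK : ∀ g ∈ C, ∀ a : K, g.1 • algebraMap K L a = algebraMap K L a :=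
    fun g _ a => (hfix _).mpr ⟨a, rfl⟩ g.1
  have : FiniteDimensional F L := Module.Finite.of_restrictScalars_finite K F L
  have h1 : Smooth (Spec.map (ofHom (structureHom hd K C hK))) := smooth_structureHom hd hfix C
  have h2 := etale_invariantsCover hd le_rfl hK hC
  have h3 : invariantsCover hd le_rfl hK hC ≫ pullback.snd _ _ =
    Spec.map (ofHom (structureHom hd F C hC)) := pullback.lift_snd _ _ _
  have h4 : Smooth (Spec.map (ofHom (structureHom hd F C hC))) := by
    rw [← h3]
    infer_instance
  exact ⟨geometricallyIntegral_structureHom hd hC hF, inferInstance, inferInstance, h4⟩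

end

variable {K : Type u} [Field K]

/-- The homomorphism `b ↦ (β b, left multiplication by b)`, through which `B` acts on the polynomial ring
`L[X_b : b ∈ B]`. Its injectivity makes the action faithful even if `β` is not injective. -/
def graphHom {A B : Type*} [Group A] [Group B] (β : B →* A) : B →* A × Equiv.Perm B :=
  β.prod (MulAction.toPermHom B B)

set_option maxHeartbeats 1000000 in
/-- The unirational arithmetical problem attached to an epimorphism `β : B → Gal(L/K)`. The variety `V`
is the spectrum of the localized invariants of `B` and `U_i` is the spectrum of those of a subgroup `H i`
which `β` maps isomorphically to `Gal(L/E_i)`. Its solution is expressed in terms of homomorphisms on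
invariants: a point `a` with values in `K` which is the identity on constants, and, over `a`, points `b`
with values in `K_x` which are the identity on constants. -/
theorem exists_rational_points (S : FieldStructure.{u, v} K) (hclosed : S.IsUnirationallyClosed)
    (L : IntermediateField K (SeparableClosure K)) [FiniteDimensional K L] [IsGalois K L]
    {B : Type} [Group B] [Finite B] (β : B →* Gal(L/K)) (hβ : Function.Surjective β)
    {I : Type} (Y : I → Set S.X) (E : I → IntermediateField K (SeparableClosure K))
    (hpart : S.gal.IsSpecialPartition (fun i => (E i).fixingSubgroup) Y)
    (hE : ∀ i, E i ≤ L) (H : I → Subgroup B) (hinj : ∀ i, ∀ b ∈ H i, β b = 1 → b = 1)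
    (hfix : ∀ i (l : L), (∀ b ∈ H i, β b l = l) ↔ (l : SeparableClosure K) ∈ E i)
    {d : MvPolynomial B L} (hd : IsSeparating (Gal(L/K) × Equiv.Perm B) d) :
    ∃ a : invariants (MvPolynomial B L) (graphHom β).range →+* K,
      a ⟨d, hd.mem _⟩ ≠ 0 ∧
      (∀ p : invariants (MvPolynomial B L) (graphHom β).range,
        ∀ e : K, (p : MvPolynomial B L) = MvPolynomial.C (algebraMap K L e) → a p = e) ∧ ∀ i, ∀ x ∈ Y i,
      ∃ b : invariants (MvPolynomial B L) ((H i).map (graphHom β)) →+* S.fld x,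
        (∀ p : invariants (MvPolynomial B L) ((H i).map (graphHom β)),
          ∀ e : L, (p : MvPolynomial B L) = MvPolynomial.C e → (b p : SeparableClosure K) = e) ∧
        ∀ p : invariants (MvPolynomial B L) (graphHom β).range,
          b (Subring.inclusion (invariants_antitone (Subgroup.map_le_range _ _)) p) =
            algebraMap K _ (a p) := by
  let alg (i : I) : Algebra (E i) L := (IntermediateField.inclusion (hE i)).toRingHom.toAlgebra
  let smul (i : I) : SMul (E i) L := (alg i).toSMul
  let mod (i : I) : Module (E i) L := (alg i).toModule
  have tower (i : I) : IsScalarTower K (E i) L := .of_algebraMap_eq' rfl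
  have fin (i : I) : FiniteDimensional K (E i) := Module.Finite.of_injective
    (IntermediateField.inclusion (hE i)).toLinearMap (IntermediateField.inclusion (hE i)).injective
  have hfixK (l : L) : (∀ a : Gal(L/K), a • l = l) ↔ l ∈ Set.range (algebraMap K L) :=
    (IsGalois.mem_range_algebraMap_iff_fixed l).symm
  have hK : ∀ g ∈ (graphHom β).range, ∀ a : K, g.1 • algebraMap K L a = algebraMap K L a :=
    fun g _ a => (hfixK _).mpr ⟨a, rfl⟩ g.1
  have hL (i : I) : ∀ g ∈ (H i).map (graphHom β), ∀ a : E i,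
      g.1 • algebraMap (E i) L a = algebraMap (E i) L a := by
    rintro _ ⟨b, hb, rfl⟩ a
    exact (hfix i _).mpr a.2 b hb
  have hLfix (i : I) : ∀ l : L, (∀ g ∈ (H i).map (graphHom β), g.1 • l = l) →
      l ∈ Set.range (algebraMap (E i) L) := fun l hl =>
    ⟨⟨l, (hfix i l).mp fun b hb => hl _ ⟨b, hb, rfl⟩⟩, rfl⟩
  let P : UnirationalProblem S :=
    { I := I
      Y := Y
      L := E
      isSpecialPartition := hpart
      V := Spec (.of (LocalizedInvariants hd (graphHom β).range))
      f := Spec.map (ofHom (structureHom hd K _ hK))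
      isAffine := inferInstance
      isSmoothVariety := isSmoothVariety_structureHom hd hK hfixK fun l hl =>
        (hfixK l).mp fun a => by
          obtain ⟨b, rfl⟩ := hβ a
          exact hl _ ⟨b, rfl⟩
      U := fun i => Spec (.of (LocalizedInvariants hd ((H i).map (graphHom β))))
      g := fun i => Spec.map (ofHom (structureHom hd (E i) _ (hL i)))
      isSmoothVariety_U := fun i =>
        isSmoothVariety_structureHom_of_isSeparable hd (K := K) (hL i) hfixK (hLfix i)
      n := Nat.card B
      dim_eq := topologicalKrullDim_localizedInvariants hd hfixK _
      birational := fun i => by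
        have : FiniteDimensional (E i) L := Module.Finite.of_restrictScalars_finite K (E i) L
        refine birationalToAffineSpace_structureHom hd (hL i) ?_ (hLfix i)
        rintro _ ⟨b, hb, rfl⟩ h
        rw [hinj i b hb (AlgEquiv.ext h), map_one]
      π := fun i => invariantsCover hd (Subgroup.map_le_range _ _) hK (hL i)
      π_snd := fun i => pullback.lift_snd _ _ _
      etale := fun i => etale_invariantsCover hd _ hK (hL i) }
  obtain ⟨⟨a, ha⟩, hb⟩ := hclosed P
  obtain ⟨a, rfl⟩ := Spec.map_surjective a
  refine ⟨a.hom.comp (algebraMap _ (LocalizedInvariants hd (graphHom β).range)), ?_, ?_, ?_⟩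
  · exact ((IsLocalization.Away.algebraMap_isUnit (S := LocalizedInvariants hd (graphHom β).range)
      (⟨d, hd.mem _⟩ : invariants (MvPolynomial B L) (graphHom β).range)).map a.hom).ne_zero
  · intro p e hp
    have h1 : ofHom (structureHom hd K _ hK) ≫ a = 𝟙 _ :=
      Spec.map_injective (by rw [Spec.map_comp, Spec.map_id]; exact ha)
    have h2 : p = coeffHom B L K _ hK e := Subtype.ext hp
    rw [h2]
    exact congrArg (fun f => f.hom e) h1
  intro i x hx
  obtain ⟨⟨b, hb₁⟩, hb₂⟩ := hb i x hx
  obtain ⟨b, rfl⟩ := Spec.map_surjective b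
  have h1 : (ofHom (structureHom hd (E i) _ (hL i))) ≫ b =
      ofHom (IntermediateField.inclusion (P.le_fld i x hx)).toRingHom :=
    Spec.map_injective (by rw [Spec.map_comp]; exact hb₁)
  have h2 : ofHom (restrictionHom hd (Subgroup.map_le_range (graphHom β) (H i))) ≫ b =
      a ≫ ofHom (algebraMap K (S.fld x)) := by
    refine Spec.map_injective ?_
    rw [Spec.map_comp, Spec.map_comp]
    refine Eq.trans ?_ hb₂
    congr 1
    exact (pullback.lift_fst _ _ _).symm
  refine ⟨b.hom.comp (algebraMap _ (LocalizedInvariants hd ((H i).map (graphHom β)))), ?_, ?_⟩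
  · intro p e hp
    have he : (e : SeparableClosure K) ∈ E i := by
      refine (hfix i e).mp fun c hc => ?_
      have h3 := mem_invariants.mp p.2 (graphHom β c) ⟨c, hc, rfl⟩
      rw [hp, twisted_smul_C] at h3
      exact MvPolynomial.C_injective _ _ h3
    have h3 := congrArg (fun f => (f.hom (⟨e, he⟩ : E i) : SeparableClosure K)) h1
    have h4 : p = coeffHom B L (E i) _ (hL i) ⟨e, he⟩ := Subtype.ext hp
    rw [h4]
    exact h3
  · intro p
    have h3 := congrArg (fun f => f.hom (algebraMap _
      (LocalizedInvariants hd (graphHom β).range) p)) h2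
    have h4 := DFunLike.congr_fun (restrictionHom_comp_algebraMap hd
      (Subgroup.map_le_range (graphHom β) (H i))) p
    refine Eq.trans ?_ h3
    exact congrArg b.hom h4.symm

end Problem

/-! ### The homomorphism given by a solution -/

section GaloisRepresentation

theorem graphHom_injective {A B : Type*} [Group A] [Group B] (β : B →* A) :
    Function.Injective (graphHom β) := fun b c h => by
  have h1 : b * 1 = c * 1 := congrArg (fun g => g.2 (1 : B)) h
  simpa using h1

/-- An embedding over `K` of a finite normal subextension becomes the inclusion after composition with an
automorphism of the subextension. -/
theorem exists_algEquiv_of_comp_C {K : Type*} [Field K]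
    (L : IntermediateField K (SeparableClosure K)) [FiniteDimensional K L] [Normal K L]
    (f : L →+* SeparableClosure K)
    (hf : ∀ e : K, f (algebraMap K L e) = algebraMap K (SeparableClosure K) e) :
    ∃ τ : Gal(L/K), ∀ l, f (τ l) = l := by
  let f' : L →ₐ[K] SeparableClosure K := { f with commutes' := hf }
  have h1 (l : L) : f l ∈ L := by
    have h2 : f' l ∈ f'.fieldRange := ⟨l, rfl⟩
    rwa [AlgHom.fieldRange_of_normal] at h2
  let f'' : L →ₐ[K] L := f'.codRestrict L.toSubalgebra h1
  let τ : Gal(L/K) := AlgEquiv.ofBijective f''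
    (Algebra.IsAlgebraic.algHom_bijective f'')
  exact ⟨τ.symm, fun l => congrArg Subtype.val (τ.apply_symm_apply l)⟩

set_option maxHeartbeats 1000000 in
/-- If `a` is the global point of a solution, extended to a homomorphism `w` on `L[X_b : b ∈ B]`, then
`Gal(K)` permutes the extensions of `a`, which are the conjugates of `w` under `B`. The homomorphism
`γ` is determined by `σ ∘ w = w ∘ γ σ`. The local point at `x` shows that some conjugate `w ∘ κ` is
defined over `K_x` on the invariants of `H i`, whence `γ` maps `Gal(K_x)` to `κ H_i κ⁻¹`. -/
theorem exists_monoidHom_of_isUnirationallyClosed {K : Type u} [Field K]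
    (S : FieldStructure.{u, v} K) (hclosed : S.IsUnirationallyClosed)
    (L : IntermediateField K (SeparableClosure K)) [FiniteDimensional K L] [IsGalois K L]
    {B : Type} [Group B] [Finite B] (β : B →* Gal(L/K)) (hβ : Function.Surjective β)
    {I : Type} (Y : I → Set S.X) (E : I → IntermediateField K (SeparableClosure K))
    (hpart : S.gal.IsSpecialPartition (fun i => (E i).fixingSubgroup) Y)
    (hE : ∀ i, E i ≤ L) (H : I → Subgroup B) (hinj : ∀ i, ∀ b ∈ H i, β b = 1 → b = 1)
    (hfix : ∀ i (l : L), (∀ b ∈ H i, β b l = l) ↔ (l : SeparableClosure K) ∈ E i) :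
    ∃ γ : Gal(SeparableClosure K/K) →* B,
      IsOpen (γ.ker : Set Gal(SeparableClosure K/K)) ∧
      (∀ σ, ∀ l : L, (β (γ σ) l : SeparableClosure K) = σ l) ∧
      ∀ i, ∀ x ∈ Y i, ∃ κ : B, β κ = 1 ∧
        ∀ σ ∈ (S.fld x).fixingSubgroup, κ⁻¹ * γ σ * κ ∈ H i := by
  obtain ⟨z, hz⟩ : ∃ z : L, ∀ τ : Gal(L/K), τ • z = z → τ = 1 :=
    ⟨(Field.powerBasisOfFiniteOfSeparable K L).gen, fun τ hτ => AlgEquiv.coe_toAlgHom_injective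
      ((Field.powerBasisOfFiniteOfSeparable K L).algHom_ext hτ)⟩
  obtain ⟨d, hd⟩ := exists_isSeparating_mvPolynomial (B := B) (K := K)
    (fun l => (IsGalois.mem_range_algebraMap_iff_fixed (F := K) (E := L) l).symm) z hz
  obtain ⟨a, had, haK, hloc⟩ :=
    exists_rational_points S hclosed L β hβ Y E hpart hE H hinj hfix hd
  -- The global point is extended to all polynomials, normalized to be the identity on `L`.
  obtain ⟨w₀, hw₀⟩ := hd.exists_extension (graphHom β).range
    ((algebraMap K (SeparableClosure K)).comp a)
    fun h => had ((map_eq_zero (algebraMap K _)).mp h)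
  obtain ⟨τ, hτ⟩ := exists_algEquiv_of_comp_C L (w₀.comp MvPolynomial.C) fun e => by
    have hmem : MvPolynomial.C (algebraMap K L e) ∈
        invariants (MvPolynomial B L) (graphHom β).range := mem_invariants.mpr fun g _ => by
      rw [twisted_smul_C]
      congr 1
      exact g.1.commutes e
    refine (hw₀ ⟨_, hmem⟩).trans ?_
    rw [RingHom.comp_apply, haK ⟨_, hmem⟩ e rfl]
  obtain ⟨b₀, rfl⟩ := hβ τ
  let w : MvPolynomial B L →+* SeparableClosure K :=
    w₀.comp (MulSemiringAction.toRingHom _ _ (graphHom β b₀))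
  have hwC (l : L) : w (MvPolynomial.C l) = l := by
    change w₀ (graphHom β b₀ • MvPolynomial.C l) = l
    rw [twisted_smul_C]
    exact hτ l
  have hwinv (p : invariants (MvPolynomial B L) (graphHom β).range) :
      w p = algebraMap K (SeparableClosure K) (a p) := by
    change w₀ (graphHom β b₀ • (p : MvPolynomial B L)) = _
    rw [mem_invariants.mp p.2 _ ⟨b₀, rfl⟩]
    exact hw₀ p
  have hwd : w d ≠ 0 := by
    rw [hwinv ⟨d, hd.mem _⟩]
    exact fun h => had ((map_eq_zero (algebraMap K _)).mp h)
  have hγ (σ : Gal(SeparableClosure K/K)) :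
      ∃ b : B, ∀ p, σ (w p) = w (graphHom β b • p) := by
    obtain ⟨_, ⟨b, rfl⟩, hb⟩ := hd.exists_smul_of_eq (graphHom β).range w
      ((σ : SeparableClosure K →+* SeparableClosure K).comp w) hwd fun p hp => by
        rw [RingHom.comp_apply, hwinv ⟨p, hp⟩]
        exact σ.commutes _
    exact ⟨b, hb⟩
  choose γ hγ using hγ
  have huniq {b c : B} (h : ∀ p, w (graphHom β b • p) = w (graphHom β c • p)) : b = c :=
    graphHom_injective β (hd.eq_of_forall_smul_eq w hwd h)
  let γ' : Gal(SeparableClosure K/K) →* B := MonoidHom.mk' γ fun σ τ => huniq fun p => by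
    rw [← hγ, map_mul, mul_smul, ← hγ, ← hγ]
    rfl
  refine ⟨γ', ?_, fun σ l => ?_, fun i x hx => ?_⟩
  · -- The kernel contains the automorphisms fixing `L` and the images of the variables.
    let M : IntermediateField K (SeparableClosure K) :=
      L ⊔ IntermediateField.adjoin K (Set.range fun b : B => w (MvPolynomial.X b))
    have : FiniteDimensional K (IntermediateField.adjoin K
        (Set.range fun b : B => w (MvPolynomial.X b))) :=
      IntermediateField.finiteDimensional_adjoin fun x _ => Algebra.IsIntegral.isIntegral x
    have : FiniteDimensional K M := IntermediateField.finiteDimensional_sup _ _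
    refine Subgroup.isOpen_mono (H₁ := M.fixingSubgroup) ?_ M.fixingSubgroup_isOpen
    intro σ hσ
    have hσ' := (IntermediateField.mem_fixingSubgroup_iff _ _).mp hσ
    refine MonoidHom.mem_ker.mpr (huniq fun p => ?_)
    change w (graphHom β (γ σ) • p) = _
    rw [← hγ, map_one, one_smul]
    refine DFunLike.congr_fun (f := (σ : SeparableClosure K →+* SeparableClosure K).comp w)
      (g := w) (MvPolynomial.ringHom_ext (fun l => ?_) fun b => ?_) p
    · rw [RingHom.comp_apply, hwC]
      exact hσ' _ (le_sup_left (a := L) l.2)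
    · refine hσ' _ (le_sup_right (a := L) ?_)
      exact IntermediateField.subset_adjoin _ _ ⟨b, rfl⟩
  · have h1 := hγ σ (MvPolynomial.C l)
    rw [twisted_smul_C, hwC, hwC] at h1
    exact h1.symm
  · obtain ⟨b, hbE, hba⟩ := hloc i x hx
    have hle := Subgroup.map_le_range (graphHom β) (H i)
    have hbd : b ⟨d, hd.mem _⟩ ≠ 0 := by
      have h1 := hba ⟨d, hd.mem _⟩
      intro h2
      exact had ((map_eq_zero (algebraMap K _)).mp (h1.symm.trans h2))
    obtain ⟨w₁, hw₁⟩ := hd.exists_extension ((H i).map (graphHom β))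
      ((algebraMap (S.fld x) (SeparableClosure K)).comp b)
      fun h => hbd ((map_eq_zero (algebraMap (S.fld x) (SeparableClosure K))).mp h)
    obtain ⟨_, ⟨κ, rfl⟩, hκ⟩ := hd.exists_smul_of_eq (graphHom β).range w w₁ hwd fun p hp => by
      rw [hwinv ⟨p, hp⟩]
      refine (hw₁ ⟨p, invariants_antitone hle hp⟩).trans ?_
      rw [RingHom.comp_apply]
      exact congrArg (algebraMap (S.fld x) (SeparableClosure K)) (hba ⟨p, hp⟩)
    -- `β κ` fixes `E i`, so that it lies in the image of `H i`.
    obtain ⟨h, hh, hhκ⟩ : β κ ∈ (H i).map β := by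
      rw [← IntermediateField.fixingSubgroup_fixedField ((H i).map β),
        IntermediateField.mem_fixingSubgroup_iff]
      intro l hl
      have hl' : ∀ c ∈ H i, β c l = l := fun c hc => hl ⟨β c, c, hc, rfl⟩
      have hmem : MvPolynomial.C l ∈ invariants (MvPolynomial B L) ((H i).map (graphHom β)) := by
        refine mem_invariants.mpr ?_
        rintro _ ⟨c, hc, rfl⟩
        rw [twisted_smul_C]
        exact congrArg MvPolynomial.C (hl' c hc)
      have h1 := hw₁ ⟨_, hmem⟩
      rw [hκ, twisted_smul_C, hwC] at h1
      exact Subtype.ext (h1.trans (hbE ⟨_, hmem⟩ l rfl))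
    have hw₂ (p : MvPolynomial B L) : w (graphHom β (κ * h⁻¹) • p) =
        w₁ (graphHom β h⁻¹ • p) := by
      rw [hκ, map_mul, mul_smul]
    refine ⟨κ * h⁻¹, by rw [map_mul, map_inv, hhκ, mul_inv_cancel], fun σ hσ => ?_⟩
    let w₂ : MvPolynomial B L →+* SeparableClosure K :=
      w.comp (MulSemiringAction.toRingHom _ _ (graphHom β (κ * h⁻¹)))
    have hw₂' (p : MvPolynomial B L) : w₂ p = w₁ (graphHom β h⁻¹ • p) := hw₂ p
    have hinv (p) (hp : p ∈ invariants (MvPolynomial B L) ((H i).map (graphHom β))) :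
        w₂ p = b ⟨p, hp⟩ := by
      rw [hw₂', mem_invariants.mp hp _ ⟨_, inv_mem hh, rfl⟩]
      exact hw₁ ⟨p, hp⟩
    obtain ⟨_, ⟨c, hc, rfl⟩, hc'⟩ := hd.exists_smul_of_eq ((H i).map (graphHom β)) w₂
      ((σ : SeparableClosure K →+* SeparableClosure K).comp w₂) (by
        rw [hinv d (hd.mem _)]
        exact fun h => hbd ((map_eq_zero (algebraMap (S.fld x) (SeparableClosure K))).mp h))
      fun p hp => by
        rw [RingHom.comp_apply, hinv p hp]
        exact (IntermediateField.mem_fixingSubgroup_iff _ _).mp hσ _ (b ⟨p, hp⟩).2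
    have h2 : γ σ * (κ * h⁻¹) = (κ * h⁻¹) * c := huniq fun p => by
      rw [map_mul, mul_smul, ← hγ, map_mul (graphHom β) (κ * h⁻¹), mul_smul]
      exact hc' p
    change (κ * h⁻¹)⁻¹ * γ σ * (κ * h⁻¹) ∈ H i
    rw [mul_assoc, h2, inv_mul_cancel_left]
    exact hc

end GaloisRepresentation

/-! ### Special partitions and lifts on spaces -/

namespace GroupStructure

section SpecialPartition

variable {S : GroupStructure.{u, v}} {A : GroupStructure.{u', v'}}

/-- If the stabilizers of `S` are the subgroups `G_x`, then the fibres of a morphism to a finite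
group structure over representatives of the orbits form a special partition. -/
theorem isSpecialPartition_fibers (φ : S.Hom A) (hA : A.IsFinite)
    (hstab : ∀ x, ∀ g ∈ (S.sub x).toSubgroup, g • x = x) {I : Type} [Finite I] (r : I → A.X)
    (hr : ∀ i, r i ∈ Set.range φ.onSpace)
    (hr' : ∀ x, ∃! i, ∃ g, φ.onSpace x = φ.onGroup g • r i) :
    S.IsSpecialPartition (fun i => (MulAction.stabilizer A.G (r i)).comap φ.onGroup)
      (fun i => φ.onSpace ⁻¹' {r i}) := by
  classical
  obtain ⟨_, _⟩ := hA
  have hopen (i) : IsOpen (((MulAction.stabilizer A.G (r i)).comap φ.onGroup : Subgroup S.G) :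
      Set S.G) := by
    rw [Subgroup.coe_comap]
    exact (isOpen_discrete _).preimage φ.continuous_onGroup
  have hfin (i) : Finite (S.G ⧸ (MulAction.stabilizer A.G (r i)).comap φ.onGroup) :=
    Subgroup.quotient_finite_of_isOpen _ (hopen i)
  have := fun i => Fintype.ofFinite (S.G ⧸ (MulAction.stabilizer A.G (r i)).comap φ.onGroup)
  have hcoset (i) (g : S.G) : ∃! ρ : S.G,
      ρ ∈ Finset.univ.image (Quotient.out :
        S.G ⧸ (MulAction.stabilizer A.G (r i)).comap φ.onGroup → S.G) ∧
      φ.onGroup ρ • r i = φ.onGroup g • r i := by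
    have key (g h : S.G) : φ.onGroup g • r i = φ.onGroup h • r i ↔
        (g : S.G ⧸ (MulAction.stabilizer A.G (r i)).comap φ.onGroup) = h := by
      rw [QuotientGroup.eq, Subgroup.mem_comap, MulAction.mem_stabilizer_iff, map_mul, map_inv,
        mul_smul, inv_smul_eq_iff, eq_comm]
    refine ⟨(g : S.G ⧸ (MulAction.stabilizer A.G (r i)).comap φ.onGroup).out,
      ⟨Finset.mem_image_of_mem _ (Finset.mem_univ _), ?_⟩, ?_⟩
    · rw [key, QuotientGroup.out_eq']
    · rintro ρ ⟨hρ, hρg⟩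
      obtain ⟨q, -, rfl⟩ := Finset.mem_image.mp hρ
      rw [key, QuotientGroup.out_eq'] at hρg
      rw [hρg]
  refine ⟨fun i => Finset.univ.image (Quotient.out :
    S.G ⧸ (MulAction.stabilizer A.G (r i)).comap φ.onGroup → S.G),
    inferInstance, fun i => ?_, hopen, ?_, ?_, ?_, ?_⟩
  · exact (isClopen_discrete {r i}).preimage φ.continuous_onSpace
  · intro i x hx g hg
    have h1 := φ.map_smul g x
    rw [hstab x g hg, hx] at h1
    exact h1.symm
  · intro i g
    rw [Subgroup.mem_comap, MulAction.mem_stabilizer_iff]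
    constructor
    · intro h
      ext x
      rw [Set.mem_smul_set_iff_inv_smul_mem, Set.mem_preimage, Set.mem_preimage, φ.map_smul,
        map_inv, Set.mem_singleton_iff, Set.mem_singleton_iff, inv_smul_eq_iff, h]
    · intro h
      obtain ⟨x, hx⟩ := hr i
      have h1 : g • x ∈ φ.onSpace ⁻¹' {r i} := h ▸ Set.smul_mem_smul_set hx
      rw [Set.mem_preimage, φ.map_smul, hx] at h1
      exact h1
  · intro i g
    obtain ⟨ρ, ⟨hρ, hρg⟩, huniq⟩ := hcoset i g
    have key (ρ : S.G) : g ∈ ρ • (((MulAction.stabilizer A.G (r i)).comap φ.onGroup :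
        Subgroup S.G) : Set S.G) ↔ φ.onGroup ρ • r i = φ.onGroup g • r i := by
      rw [Set.mem_smul_set_iff_inv_smul_mem, SetLike.mem_coe, Subgroup.mem_comap,
        MulAction.mem_stabilizer_iff, smul_eq_mul, map_mul, map_inv, mul_smul, inv_smul_eq_iff,
        eq_comm]
    exact ⟨ρ, ⟨hρ, (key ρ).mpr hρg⟩, fun ρ' h => huniq ρ' ⟨h.1, (key ρ').mp h.2⟩⟩
  · intro x
    obtain ⟨i, ⟨g, hg⟩, hi⟩ := hr' x
    obtain ⟨ρ, ⟨hρ, hρg⟩, huniq⟩ := hcoset i g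
    have key (j) (ρ : S.G) : x ∈ ρ • φ.onSpace ⁻¹' {r j} ↔
        φ.onSpace x = φ.onGroup ρ • r j := by
      rw [Set.mem_smul_set_iff_inv_smul_mem, Set.mem_preimage, φ.map_smul, map_inv,
        Set.mem_singleton_iff, inv_smul_eq_iff]
    refine ⟨(i, ρ), ⟨hρ, (key i ρ).mpr (hg.trans hρg.symm)⟩, ?_⟩
    rintro ⟨j, ρ'⟩ ⟨h1, h2⟩
    have h3 := (key j ρ').mp h2
    obtain rfl : j = i := hi j ⟨ρ', h3⟩
    rw [huniq ρ' ⟨h1, h3.symm.trans hg⟩]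

end SpecialPartition

section LiftOnSpaces

variable {S : GroupStructure.{u, v}} {A B : GroupStructure.{u', v'}} (φ : S.Hom A) (α : B.Hom A)
  (γ : S.G →* B.G)

/-- A map from a subset `W` of the space of `S` is a partial lift of `φ` over `γ` if `W` is open,
closed and stable under the group, and the map satisfies on `W` the conditions on a morphism
lifting `φ`. -/
structure IsPartialLift (W : Set S.X) (f : S.X → B.X) : Prop where
  isClopen : IsClopen W
  smul_mem : ∀ g : S.G, ∀ x ∈ W, g • x ∈ W
  continuousOn : ContinuousOn f W
  map_smul : ∀ g : S.G, ∀ x ∈ W, f (g • x) = γ g • f x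
  map_sub_le : ∀ x ∈ W, (S.sub x).toSubgroup.map γ ≤ (B.sub (f x)).toSubgroup
  lift : ∀ x ∈ W, α.onSpace (f x) = φ.onSpace x

variable {φ α γ}

theorem IsPartialLift.smul_mem_iff {W : Set S.X} {f : S.X → B.X} (h : IsPartialLift φ α γ W f)
    (g : S.G) (x : S.X) : g • x ∈ W ↔ x ∈ W :=
  ⟨fun hx => by simpa using h.smul_mem g⁻¹ _ hx, h.smul_mem g x⟩

open Classical in
theorem IsPartialLift.union {W₁ W₂ : Set S.X} {f₁ f₂ : S.X → B.X}
    (h₁ : IsPartialLift φ α γ W₁ f₁) (h₂ : IsPartialLift φ α γ W₂ f₂) :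
    IsPartialLift φ α γ (W₁ ∪ W₂) (W₁.piecewise f₁ f₂) where
  isClopen := h₁.isClopen.union h₂.isClopen
  smul_mem g x hx := hx.imp (h₁.smul_mem g x) (h₂.smul_mem g x)
  continuousOn := by
    have e₁ : Set.EqOn (W₁.piecewise f₁ f₂) f₁ W₁ := Set.piecewise_eqOn _ _ _
    have e₂ : Set.EqOn (W₁.piecewise f₁ f₂) f₂ (W₂ \ W₁) :=
      (Set.piecewise_eqOn_compl _ _ _).mono fun x hx => hx.2
    rw [← Set.union_sdiff_self]
    exact (h₁.continuousOn.congr e₁).union_of_isOpen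
      ((h₂.continuousOn.mono Set.sdiff_subset).congr e₂) h₁.isClopen.isOpen
      (h₂.isClopen.diff h₁.isClopen).isOpen
  map_smul g x hx := by
    by_cases hx₁ : x ∈ W₁
    · rw [Set.piecewise_eq_of_mem _ _ _ hx₁, Set.piecewise_eq_of_mem _ _ _ (h₁.smul_mem g x hx₁),
        h₁.map_smul g x hx₁]
    · rw [Set.piecewise_eq_of_notMem _ _ _ hx₁,
        Set.piecewise_eq_of_notMem _ _ _ (mt (h₁.smul_mem_iff g x).mp hx₁),
        h₂.map_smul g x (hx.resolve_left hx₁)]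
  map_sub_le x hx := by
    by_cases hx₁ : x ∈ W₁
    · rw [Set.piecewise_eq_of_mem _ _ _ hx₁]
      exact h₁.map_sub_le x hx₁
    · rw [Set.piecewise_eq_of_notMem _ _ _ hx₁]
      exact h₂.map_sub_le x (hx.resolve_left hx₁)
  lift x hx := by
    by_cases hx₁ : x ∈ W₁
    · rw [Set.piecewise_eq_of_mem _ _ _ hx₁]
      exact h₁.lift x hx₁
    · rw [Set.piecewise_eq_of_notMem _ _ _ hx₁]
      exact h₂.lift x (hx.resolve_left hx₁)

/-- In a cover, a lift of an element fixing `φ x` that lies in `B_y` fixes the point `y` over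
`φ x`. -/
theorem Hom.IsCover.smul_eq_of_mem_sub (hα : α.IsCover) {y : B.X} {b : B.G}
    (hb : b ∈ (B.sub y).toSubgroup) (h : α.onGroup b • α.onSpace y = α.onSpace y) : b • y = y := by
  obtain ⟨k, hk, hky⟩ := hα.exists_ker_smul_eq y (b • y) (by rw [α.map_smul, h])
  have h1 : k⁻¹ * b ∈ (B.sub y).toSubgroup := B.stabilizer_le y <| by
    rw [MulAction.mem_stabilizer_iff, mul_smul, inv_smul_eq_iff, hky]
  have h2 : k ∈ (B.sub y).toSubgroup := by
    simpa using mul_mem hb (inv_mem h1)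
  have h3 : k = 1 := (hα.bijOn_sub y).injOn h2 (one_mem (B.sub y).toSubgroup)
    (by rw [MonoidHom.mem_ker.mp hk, map_one])
  rw [← hky, h3, one_smul]

/-- By compactness, small neighbourhoods of `x` only meet their translates by elements of a given open
subgroup which contains the stabilizer of `x`. -/
theorem exists_isClopen_forall_smul_mem (x : S.X) (U : Subgroup S.G) (hU : IsOpen (U : Set S.G))
    (hx : MulAction.stabilizer S.G x ≤ U) (N : Set S.X) (hN : N ∈ 𝓝 x) :
    ∃ Z : Set S.X, IsClopen Z ∧ x ∈ Z ∧ Z ⊆ N ∧ ∀ g : S.G, ∀ z ∈ Z, g • z ∈ Z → g ∈ U := by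
  let T : Set (S.X × S.X) := (fun p : S.G × S.X => (p.2, p.1 • p.2)) '' ((U : Set S.G)ᶜ ×ˢ Set.univ)
  have hT : IsClosed T :=
    ((hU.isClosed_compl.isCompact.prod isCompact_univ).image (by fun_prop)).isClosed
  have hxT : Tᶜ ∈ 𝓝 (x, x) := by
    refine hT.isOpen_compl.mem_nhds ?_
    rintro ⟨⟨g, z⟩, ⟨hg, -⟩, h⟩
    obtain ⟨rfl, h2⟩ := Prod.mk.inj h
    exact hg (hx h2)
  rw [nhds_prod_eq, Filter.mem_prod_self_iff] at hxT
  obtain ⟨V, hV, hVT⟩ := hxT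
  obtain ⟨Z, hZ, hxZ, hZV⟩ := compact_exists_isClopen_in_isOpen
    (isOpen_interior (s := V ∩ N)) (mem_interior_iff_mem_nhds.mpr (Filter.inter_mem hV hN))
  have hZ' := hZV.trans interior_subset
  refine ⟨Z, hZ, hxZ, fun z hz => (hZ' hz).2, fun g z hz hgz => ?_⟩
  by_contra hg
  exact hVT ⟨(hZ' hz).1, (hZ' hgz).1⟩ ⟨(g, z), ⟨hg, trivial⟩, rfl⟩

/-- Near `x`, send `g • z` to `γ g • y` for all `z` in a small neighbourhood `Z` of `x`. This is well defined
on the union of the translates of `Z`, since `γ` maps the stabilizer of `x` to that of `y`. -/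
theorem exists_isPartialLift (hα : α.IsCover) (hB : B.IsFinite)
    (hγ : Continuous γ)
    (hγα : ∀ g, α.onGroup (γ g) = φ.onGroup g) (x : S.X) (y : B.X)
    (hy : α.onSpace y = φ.onSpace x) (hxy : (S.sub x).toSubgroup.map γ ≤ (B.sub y).toSubgroup) :
    ∃ W ∈ 𝓝 x, ∃ f, IsPartialLift φ α γ W f := by
  obtain ⟨_, _⟩ := hB
  have : Finite A.X := Finite.of_surjective _ hα.isEpi.surjective_onSpace
  let U : Subgroup S.G := (MulAction.stabilizer B.G y).comap γ
  have hU : IsOpen (U : Set S.G) := by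
    rw [Subgroup.coe_comap]
    exact (isOpen_discrete _).preimage hγ
  let V : OpenSubgroup S.G := ⟨(B.sub y).toSubgroup.comap γ, (isOpen_discrete _).preimage hγ⟩
  have h1 : MulAction.stabilizer S.G x ≤ U := fun g hg => by
    refine hα.smul_eq_of_mem_sub (hxy ⟨g, S.stabilizer_le x hg, rfl⟩) ?_
    rw [hγα, hy, ← φ.map_smul, MulAction.mem_stabilizer_iff.mp hg]
  have h2 : {z | (S.sub z).toSubgroup ≤ V.toSubgroup} ∈ 𝓝 x :=
    (continuous_generateFrom_iff.mp S.sub_continuous _ ⟨V, rfl⟩).mem_nhds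
      (Subgroup.map_le_iff_le_comap.mp hxy)
  have h3 : φ.onSpace ⁻¹' {φ.onSpace x} ∈ 𝓝 x :=
    ((isOpen_discrete _).preimage φ.continuous_onSpace).mem_nhds rfl
  obtain ⟨Z, hZ, hxZ, hZN, hZU⟩ :=
    exists_isClopen_forall_smul_mem x U hU h1 _ (Filter.inter_mem h2 h3)
  let W : Set S.X := {w | ∃ g : S.G, g⁻¹ • w ∈ Z}
  classical
  let f (w : S.X) : B.X := if h : ∃ g : S.G, g⁻¹ • w ∈ Z then γ h.choose • y else y
  have hf (g : S.G) (w : S.X) (h : g⁻¹ • w ∈ Z) : f w = γ g • y := by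
    have h4 : ∃ g : S.G, g⁻¹ • w ∈ Z := ⟨g, h⟩
    have h5 : g⁻¹ * h4.choose ∈ U := hZU _ _ h4.choose_spec <| by
      rwa [mul_smul, smul_inv_smul]
    have h6 : γ (g⁻¹ * h4.choose) • y = y := h5
    rw [map_mul, map_inv, mul_smul, inv_smul_eq_iff] at h6
    simp only [f, dif_pos h4, h6]
  have hZW (g : S.G) : IsOpen {w : S.X | g⁻¹ • w ∈ Z} :=
    hZ.isOpen.preimage (continuous_const_smul g⁻¹)
  have hWo : IsOpen W := by
    rw [show W = ⋃ g : S.G, {w : S.X | g⁻¹ • w ∈ Z} by ext; simp [W]]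
    exact isOpen_iUnion hZW
  have hWc : IsClosed W := by
    have : W = (fun p : S.G × S.X => p.1 • p.2) '' (Set.univ ×ˢ Z) := by
      ext w
      constructor
      · rintro ⟨g, hg⟩
        exact ⟨(g, g⁻¹ • w), ⟨trivial, hg⟩, smul_inv_smul g w⟩
      · rintro ⟨⟨g, z⟩, ⟨-, hz⟩, rfl⟩
        exact ⟨g, by simpa using hz⟩
    rw [this]
    exact ((isCompact_univ.prod hZ.isClosed.isCompact).image (by fun_prop)).isClosed
  refine ⟨W, hWo.mem_nhds ⟨1, by simpa using hxZ⟩, f, ⟨hWc, hWo⟩, ?_, ?_, ?_, ?_, ?_⟩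
  · rintro g w ⟨h, hw⟩
    exact ⟨g * h, by rwa [mul_inv_rev, mul_smul, inv_smul_smul]⟩
  · rintro w ⟨g, hg⟩
    refine ContinuousAt.continuousWithinAt ?_
    refine ContinuousAt.congr (f := fun _ => γ g • y) continuousAt_const ?_
    filter_upwards [(hZW g).mem_nhds hg] with v hv
    exact (hf g v hv).symm
  · rintro g w ⟨h, hw⟩
    rw [hf (g * h) (g • w) (by rwa [mul_inv_rev, mul_smul, inv_smul_smul]), hf h w hw, map_mul,
      mul_smul]
  · rintro w ⟨g, hg⟩
    have h4 : (S.sub (g⁻¹ • w)).toSubgroup ≤ (B.sub y).toSubgroup.comap γ := (hZN hg).1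
    rw [hf g w hg, B.sub_smul, Subgroup.map_le_iff_le_comap]
    intro s hs
    have h5 := h4 (x := g⁻¹ * s * g) (by
      rw [S.sub_smul, Subgroup.mem_pointwise_smul_iff_inv_smul_mem, ← map_inv, inv_inv,
        MulAut.smul_def, MulAut.conj_apply]
      simpa [mul_assoc] using hs)
    rw [Subgroup.mem_comap, Subgroup.mem_pointwise_smul_iff_inv_smul_mem, ← map_inv,
      MulAut.smul_def, MulAut.conj_apply]
    simpa using h5
  · rintro w ⟨g, hg⟩
    have h4 : φ.onSpace (g⁻¹ • w) = φ.onSpace x := (hZN hg).2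
    rw [hf g w hg, α.map_smul, hγα, hy, ← h4, ← φ.map_smul, smul_inv_smul]

/-- A lift of the group homomorphism extends to the spaces if it exists pointwise. -/
theorem exists_hom_lift (hα : α.IsCover) (hB : B.IsFinite)
    (hγ : Continuous γ)
    (hγα : ∀ g, α.onGroup (γ g) = φ.onGroup g)
    (h : ∀ x, ∃ y, α.onSpace y = φ.onSpace x ∧
      (S.sub x).toSubgroup.map γ ≤ (B.sub y).toSubgroup) :
    ∃ δ : S.Hom B, (∀ g, α.onGroup (δ.onGroup g) = φ.onGroup g) ∧
      (∀ x, α.onSpace (δ.onSpace x) = φ.onSpace x) := by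
  classical
  obtain ⟨W, hW, f, hf⟩ : ∃ W, Set.univ ⊆ W ∧ ∃ f, IsPartialLift φ α γ W f := by
    refine isCompact_univ.induction_on (p := fun s : Set S.X => ∃ W, s ⊆ W ∧
      ∃ f, IsPartialLift φ α γ W f) ?_ ?_ ?_ ?_
    · exact ⟨∅, subset_rfl, fun x => (h x).choose, isClopen_empty, by simp, by simp, by simp,
        by simp, by simp⟩
    · rintro s t hst ⟨W, hW, hf⟩
      exact ⟨W, hst.trans hW, hf⟩
    · rintro s t ⟨W₁, hW₁, f₁, hf₁⟩ ⟨W₂, hW₂, f₂, hf₂⟩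
      exact ⟨W₁ ∪ W₂, Set.union_subset_union hW₁ hW₂, _, hf₁.union hf₂⟩
    · intro x _
      obtain ⟨y, hy, hxy⟩ := h x
      obtain ⟨W, hW, hf⟩ := exists_isPartialLift hα hB hγ hγα x y hy hxy
      exact ⟨W, mem_nhdsWithin_of_mem_nhds hW, W, subset_rfl, hf⟩
  obtain rfl : W = Set.univ := Set.univ_subset_iff.mp hW
  exact ⟨⟨γ, f, hγ, continuousOn_univ.mp hf.continuousOn, fun g x => hf.map_smul g x trivial,
    fun x => hf.map_sub_le x trivial⟩, hγα, fun x => hf.lift x trivial⟩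

end LiftOnSpaces

end GroupStructure

/-! ### Finite embedding problems -/

section Assembly

/-- Representatives of the orbits of a group `G`, acting through `φ`, that meet the image of a map,
chosen in that image. -/
theorem exists_orbit_representatives {G X Y H : Type*} [Group G] [Group H]
    [MulAction H Y] (φ : G →* H) (f : X → Y) :
    ∃ I : Set Y, I ⊆ Set.range f ∧ ∀ x, ∃! i : I, ∃ g, f x = φ g • (i : Y) := by
  let s : Setoid X :=
    { r := fun x x' => ∃ g, f x = φ g • f x'
      iseqv := ⟨fun x => ⟨1, by simp⟩, fun {x x'} ⟨g, h⟩ => ⟨g⁻¹, by simp [h]⟩,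
        fun {x x' x''} ⟨g, h⟩ ⟨g', h'⟩ => ⟨g * g', by rw [h, h', map_mul, mul_smul]⟩⟩ }
  refine ⟨Set.range fun q : Quotient s => f q.out, ?_, fun x => ?_⟩
  · rintro _ ⟨q, rfl⟩
    exact ⟨_, rfl⟩
  · refine ⟨⟨_, ⟦x⟧, rfl⟩, Setoid.symm (Quotient.mk_out x), ?_⟩
    rintro ⟨_, q, rfl⟩ ⟨g, hg⟩
    have : q = ⟦x⟧ := by
      rw [← q.out_eq]
      exact Quotient.sound (Setoid.symm ⟨g, hg⟩)
    rw [this]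

/-- Given homomorphisms `φ : G → A ← B : α` and `r` on `G` with the same kernel as `φ`, the
homomorphism induced by `r` on the preimage of `φ(G)` under `α`. -/
theorem exists_monoidHom_preimage_range {G A B Q : Type*} [Group G] [Group A] [Group B]
    [Group Q] (φ : G →* A) (α : B →* A) (r : G →* Q) (hr : ∀ g, r g = 1 ↔ φ g = 1) :
    ∃ β : φ.range.comap α →* Q, ∀ (b : φ.range.comap α) (g : G), β b = r g ↔ α b = φ g := by
  have key (g h : G) : r g = r h ↔ φ g = φ h := by
    rw [← inv_mul_eq_one, ← map_inv, ← map_mul, hr, map_mul, map_inv, inv_mul_eq_one]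
  choose s hs using fun b : φ.range.comap α => b.2
  have h (b : φ.range.comap α) (g : G) : r (s b) = r g ↔ α b = φ g := by rw [key, hs]
  exact ⟨MonoidHom.mk' (fun b => r (s b)) fun b c => by
    rw [← map_mul, h, map_mul, hs, hs, Subgroup.coe_mul, map_mul], h⟩

theorem continuous_of_isOpen_ker {G H : Type*} [Group G] [TopologicalSpace G]
    [IsTopologicalGroup G] [Group H] [TopologicalSpace H] [DiscreteTopology H] (f : G →* H)
    (hf : IsOpen (f.ker : Set G)) : Continuous f := by
  have : IsTopologicalGroup H := {}
  refine continuous_of_continuousAt_one f ?_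
  rw [ContinuousAt, map_one, nhds_discrete H, Filter.tendsto_pure]
  filter_upwards [hf.mem_nhds f.ker.one_mem] with g hg using hg

end Assembly

theorem proposition6p4 {K : Type u} [Field K] (S : FieldStructure.{u, v} K)
    (hclosed : S.IsUnirationallyClosed)
    (hstab : ∀ x : S.X,
      MulAction.stabilizer Gal(SeparableClosure K/K) x = (S.fld x).fixingSubgroup) :
    S.gal.IsProjective := by
  intro A B φ α hB hα
  obtain ⟨_, _⟩ := id hB
  have : Finite A.G := Finite.of_surjective _ hα.isEpi.surjective_onGroup
  have : Finite A.X := Finite.of_surjective _ hα.isEpi.surjective_onSpace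
  have hstab' : ∀ x, ∀ g ∈ (S.gal.sub x).toSubgroup, g • x = x := fun x g hg => by
    have h1 : g ∈ (S.fld x).fixingSubgroup := hg
    rwa [← hstab] at h1
  let φ₀ : Gal(SeparableClosure K/K) →* A.G := φ.onGroup
  have hφ₀ : Continuous φ₀ := φ.continuous_onGroup
  -- The fixed field of the kernel of `φ`.
  let N : ClosedSubgroup Gal(SeparableClosure K/K) :=
    ⟨φ₀.ker, (isClosed_discrete {1}).preimage hφ₀⟩
  let L : IntermediateField K (SeparableClosure K) := IntermediateField.fixedField φ₀.ker
  have hL : L.fixingSubgroup = φ₀.ker := InfiniteGalois.fixingSubgroup_fixedField N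
  have : FiniteDimensional K L := by
    rw [← InfiniteGalois.isOpen_iff_finite, hL]
    exact (isOpen_discrete {1}).preimage hφ₀
  have : IsGalois K L := by
    rw [← InfiniteGalois.normal_iff_isGalois, hL]
    infer_instance
  have hres (σ : Gal(SeparableClosure K/K)) (l : L) :
      (AlgEquiv.restrictNormalHom L σ l : SeparableClosure K) = σ l :=
    AlgEquiv.restrictNormal_commutes σ L l
  obtain ⟨β, hβ⟩ := exists_monoidHom_preimage_range φ₀ α.onGroup
    (AlgEquiv.restrictNormalHom (F := K) (K₁ := SeparableClosure K) L) fun σ => by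
      rw [← MonoidHom.mem_ker, IntermediateField.restrictNormalHom_ker, hL, MonoidHom.mem_ker]
  have hβsurj : Function.Surjective β := fun τ => by
    obtain ⟨σ, rfl⟩ := AlgEquiv.restrictNormalHom_surjective (F := K) (K₁ := L)
      (SeparableClosure K) τ
    obtain ⟨b, hb⟩ := hα.isEpi.surjective_onGroup (φ₀ σ)
    exact ⟨⟨b, σ, hb.symm⟩, (hβ _ _).mpr hb⟩
  have hβone (b : φ₀.range.comap α.onGroup) : β b = 1 ↔ α.onGroup b = 1 := by
    have h := hβ b 1
    rwa [map_one, map_one] at h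
  -- The special partition by the fibres of `φ` over representatives of orbits.
  obtain ⟨I, hI, hI'⟩ := exists_orbit_representatives φ.onGroup φ.onSpace
  have hpart := GroupStructure.isSpecialPartition_fibers φ ⟨‹_›, ‹_›⟩ hstab'
    (fun i : I => (i : A.X)) (fun i => hI i.2) hI'
  let D (i : I) : Subgroup Gal(SeparableClosure K/K) :=
    (MulAction.stabilizer A.G (i : A.X)).comap φ₀
  let E (i : I) : IntermediateField K (SeparableClosure K) := IntermediateField.fixedField (D i)
  have hE (i : I) : (E i).fixingSubgroup = D i :=
    InfiniteGalois.fixingSubgroup_fixedField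
      ⟨D i, (isClosed_discrete (MulAction.stabilizer A.G (i : A.X) : Set A.G)).preimage hφ₀⟩
  -- The subgroups `H i` map isomorphically to the images of the `D i`, because `α` is injective on `B_y`.
  choose y hy using fun i : I => hα.isEpi.surjective_onSpace (i : A.X)
  let H (i : I) : Subgroup (φ₀.range.comap α.onGroup) :=
    ((B.sub (y i)).toSubgroup ⊓
      (MulAction.stabilizer A.G (i : A.X)).comap α.onGroup).subgroupOf _
  have hH (i : I) (b) : b ∈ H i ↔ (b : B.G) ∈ (B.sub (y i)).toSubgroup ∧
      α.onGroup b ∈ MulAction.stabilizer A.G (i : A.X) := Iff.rfl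
  obtain ⟨γ, hγo, hγβ, hγloc⟩ := exists_monoidHom_of_isUnirationallyClosed S hclosed L β hβsurj
    (fun i : I => φ.onSpace ⁻¹' {(i : A.X)}) E (by simp only [hE]; exact hpart)
    (fun i => IntermediateField.fixedField_antitone fun σ hσ => by
      rw [Subgroup.mem_comap, MonoidHom.mem_ker.mp hσ]
      exact one_mem _) H
    (fun i b hb h => Subtype.ext ((hα.bijOn_sub (y i)).injOn hb.1
      (one_mem (B.sub (y i)).toSubgroup)
      (((hβone b).mp h).trans (map_one α.onGroup).symm)))
    fun i l => by
      constructor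
      · rintro h ⟨σ, hσ⟩
        have h1 : φ₀ σ ∈ A.sub (α.onSpace (y i)) := by
          rw [hy]
          exact A.stabilizer_le _ hσ
        obtain ⟨b, hb, hbσ⟩ := (hα.bijOn_sub (y i)).surjOn h1
        have h2 := h ⟨b, σ, hbσ.symm⟩ ((hH _ _).mpr ⟨hb, by rw [hbσ]; exact hσ⟩)
        rw [(hβ _ σ).mpr hbσ] at h2
        exact (hres σ l).symm.trans (congrArg Subtype.val h2)
      · intro h b hb
        obtain ⟨σ, hσ⟩ := b.2
        rw [(hβ b σ).mpr hσ.symm]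
        refine Subtype.ext ((hres σ l).trans (h ⟨σ, ?_⟩))
        rw [Subgroup.mem_comap, hσ]
        exact hb.2
  have hγα (σ) : α.onGroup (γ σ) = φ₀ σ := (hβ _ _).mp <| AlgEquiv.ext fun l =>
    Subtype.ext ((hγβ σ l).trans (hres σ l).symm)
  let γ' : S.gal.G →* B.G := (Subgroup.subtype _).comp γ
  have hγ' : Continuous γ' := continuous_of_isOpen_ker γ' <| by
    rwa [show γ'.ker = γ.ker from Subgroup.ext fun σ => OneMemClass.coe_eq_one]
  refine GroupStructure.exists_hom_lift hα hB hγ' hγα fun x => ?_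
  obtain ⟨i, ⟨g, hg⟩, -⟩ := hI' x
  obtain ⟨κ, hκ, hκH⟩ := hγloc i (g⁻¹ • x) (by
    rw [Set.mem_preimage, φ.map_smul, hg, map_inv, inv_smul_smul]
    rfl)
  -- The point `κ • y i` lies over `φ (g⁻¹ x)`, because `κ` lies in the kernel of `α`.
  refine ⟨γ' g • (κ : B.G) • y i, ?_, ?_⟩
  · have h1 : α.onGroup (γ' g) = φ.onGroup g := hγα g
    rw [α.map_smul, α.map_smul, (hβone κ).mp hκ, one_smul, hy, h1, hg]
  · rintro _ ⟨σ, hσ, rfl⟩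
    have h1 : g⁻¹ * σ * g ∈ (S.fld (g⁻¹ • x)).fixingSubgroup := by
      change g⁻¹ * σ * g ∈ (S.gal.sub (g⁻¹ • x)).toSubgroup
      rw [S.gal.sub_smul, Subgroup.mem_pointwise_smul_iff_inv_smul_mem, ← map_inv, inv_inv,
        MulAut.smul_def, MulAut.conj_apply]
      simpa [mul_assoc] using hσ
    have h2 := ((hH _ _).mp (hκH _ h1)).1
    rw [B.sub_smul, B.sub_smul, Subgroup.mem_pointwise_smul_iff_inv_smul_mem,
      Subgroup.mem_pointwise_smul_iff_inv_smul_mem, ← map_inv, ← map_inv,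
      MulAut.smul_def, MulAut.conj_apply, MulAut.smul_def, MulAut.conj_apply]
    simpa [γ', mul_assoc] using h2
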